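/- Conventions. A random vector $(Y_1,\dots,Y_n)$ is MTP$_2$ if its law has, with respect to some product $\nu_1\otimes\cdots\otimes\nu_n$ of $\sigma$-finite measures on $\mathbb R$, a density $p:\mathbb R^n\to\mathbb R_+$ with $p(x\wedge y)\,p(x\vee y)\ge p(x)\,p(y)$ for all $x,y\in\mathbb R^n$ (componentwise minimum and maximum). It is strongly conditionally monotone (SCM) if, for every $i\in\{1,\dots,n\}$, all continuous $f_1,\dots,f_n:\mathbb R\to(0,\infty)$ with $\mathbb E[\prod_k f_k(Y_k)]<\infty$, and every bounded continuous componentwise non-decreasing $\phi:\mathbb R^n\to\mathbb R$, the function $$z\longmapsto \frac{\mathbb E\big[\phi(Y_1,\dots,Y_n)\prod_k f_k(Y_k)\,\big|\,Y_i=z\big]}{\mathbb E\big[\prod_k f_k(Y_k)\,\big|\,Y_i=z\big]}$$ has a non-decreasing version. A real process $(X_t)_{t\ge0}$ is SCM if $(X_{t_1},\dots,X_{t_n})$ is SCM for every $n$ and all pairwise distinct $t_1,\dots,t_n\ge 0$. A kernel $P$ on an interval $I\subseteq\mathbb R$ is TP$_2$ if $P(x_1,E_1)P(x_2,E_2)\ge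 P(x_1,E_2)P(x_2,E_1)$ for all $x_1<x_2$ in $I$ and all Borel sets $E_1,E_2\subseteq I$ such that $a<b$ for all $a\in E_1$, $b\in E_2$; it is absolutely continuous if there is a $\sigma$-finite measure $\nu$ on $I$ (for example Lebesgue measure) with $P(x,\cdot)\ll\nu$ for all $x\in I$. Statement. 1. If $(X_{t_1},\dots,X_{t_n})$ is MTP$_2$ for every $n\ge2$ and all pairwise distinct $t_1,\dots,t_n\ge0$, then the real process $(X_t)_{t\ge0}$ is SCM. 2. If $(X_t)_{t\ge0}$ is a Markov process with values in an interval $I\subseteq\mathbb R$, with any initial law, whose transition kernels $P_{s,t}$, $0\le s<t$, are absolutely continuous and TP$_2$, then $X$ is SCM. 3. Let $(X_t)_{t\ge0}$ be a real process such that $X_t-X_s$ is independent of $\sigma(X_u;\,u\le s)$ for all $0\le s\le t$. If, for all $0\le s<t$, $X_t-X_s$ has a log-concave density with respect to Lebesgue measure, then $X$ is SCM. The same holds if every $X_t$ is almost surely $\mathbb Z$-valued and, for all $0\le s<t$, the sequence $p(k)=\mathbb P(X_t-X_s=k)$ is log-concave, that is, $p(k)^2\ge p(k-1)p(k+1)$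 for all $k\in\mathbb Z$ and $\{k:p(k)>0\}$ has no gaps. 4. Let $((X_t)_{t\ge0},(\mathbb P_x)_{x\in I})$ be a one-dimensional diffusion on an interval $I\subseteq\mathbb R$, that is, a time-homogeneous strong Markov process (with respect to its natural filtration) with values in $I$, with continuous paths, and with $X_0=x$ $\mathbb P_x$-almost surely. If the kernel $P_t(x,dy)=\mathbb P_x(X_t\in dy)$ is absolutely continuous for every $t>0$, then $X$ is SCM under $\mathbb P_\rho=\int_I\mathbb P_x\,\rho(dx)$ for every probability measure $\rho$ on $I$; in particular it is SCM under every $\mathbb P_x$. -/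

import Mathlib

open MeasureTheory ProbabilityTheory Set
open scoped NNReal ENNReal BoundedContinuousFunction

namespace SCM

/-- `p : ℝⁿ → ℝ₊` is multivariate totally positive of order 2:
`p(x) p(y) ≤ p(x ∧ y) p(x ∨ y)`, with componentwise minima and maxima. -/
def IsMTP2 {n : ℕ} (p : (Fin n → ℝ) → ℝ≥0) : Prop :=
  ∀ x y : Fin n → ℝ, p x * p y ≤ p (x ⊓ y) * p (x ⊔ y)

/-- The random vector `(Y 0, …, Y (n-1))` is MTP₂: its law has an MTP₂ density with respect to some
product of σ-finite measures on `ℝ`. -/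
def IsMTP2Vector {Ω : Type*} [MeasurableSpace Ω] {n : ℕ} (Y : Fin n → Ω → ℝ) (μ : Measure Ω) :
    Prop :=
  ∃ ν : Fin n → Measure ℝ, (∀ k, SigmaFinite (ν k)) ∧
    ∃ p : (Fin n → ℝ) → ℝ≥0, Measurable p ∧ IsMTP2 p ∧
      μ.map (fun ω k => Y k ω) = (Measure.pi ν).withDensity (fun x => (p x : ℝ≥0∞))

/-- The finite-dimensional marginals, at pairwise distinct times, of the process are MTP₂. -/
def HasMTP2Marginals {Ω : Type*} [MeasurableSpace Ω] (X : ℝ≥0 → Ω → ℝ) (μ : Measure Ω) : Prop :=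
  ∀ n : ℕ, 2 ≤ n → ∀ t : Fin n → ℝ≥0, Function.Injective t →
    IsMTP2Vector (fun k => X (t k)) μ

/-- The random vector `(Y 0, …, Y (n-1))` is strongly conditionally monotone. The function
`K i (n, z) = E[φ(Y) ∏ₖ fₖ(Yₖ) | Yᵢ = z] / E[∏ₖ fₖ(Yₖ) | Yᵢ = z]` is defined up to sets of `z` that
are null for the law of `Yᵢ`; it is required to have a non-decreasing version. -/
def IsSCMVector {Ω : Type*} [MeasurableSpace Ω] {n : ℕ} (Y : Fin n → Ω → ℝ) (μ : Measure Ω) :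
    Prop :=
  ∀ (i : Fin n) (f : Fin n → ℝ → ℝ), (∀ k, Continuous (f k)) → (∀ k x, 0 < f k x) →
    Integrable (fun ω => ∏ k, f k (Y k ω)) μ →
    ∀ φ : (Fin n → ℝ) →ᵇ ℝ, Monotone φ →
      ∃ K : ℝ → ℝ, Monotone K ∧
        (fun ω => K (Y i ω)) =ᵐ[μ] fun ω =>
          (μ[fun ω => φ (fun k => Y k ω) * ∏ k, f k (Y k ω) |
              MeasurableSpace.comap (Y i) inferInstance]) ω /
            (μ[fun ω => ∏ k, f k (Y k ω) | MeasurableSpace.comap (Y i) inferInstance]) ω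

/-- The process is strongly conditionally monotone: its finite-dimensional marginals, at pairwise
distinct times, are. -/
def IsSCM {Ω : Type*} [MeasurableSpace Ω] (X : ℝ≥0 → Ω → ℝ) (μ : Measure Ω) : Prop :=
  ∀ (n : ℕ) (t : Fin n → ℝ≥0), Function.Injective t → IsSCMVector (fun k => X (t k)) μ

/-- The history `σ(X u ; u ≤ s)` of a process. -/
abbrev past {Ω E : Type*} [MeasurableSpace E] (X : ℝ≥0 → Ω → E) (s : ℝ≥0) : MeasurableSpace Ω :=
  ⨆ u ≤ s, MeasurableSpace.comap (X u) inferInstance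

/-- `X` is a Markov process, with respect to its own history, with transition probabilities
`P s t (x, dy)`, `s < t`. The initial law is arbitrary. -/
structure IsMarkovProcess {Ω E : Type*} [MeasurableSpace Ω] [MeasurableSpace E]
    (X : ℝ≥0 → Ω → E) (P : ℝ≥0 → ℝ≥0 → Kernel E E) (μ : Measure Ω) : Prop where
  measurable : ∀ t, Measurable (X t)
  markovKernel : ∀ s t, s < t → IsMarkovKernel (P s t)
  condProb_eq : ∀ s t, s < t → ∀ B : Set E, MeasurableSet B →
    (μ[(X t ⁻¹' B).indicator (fun _ => (1 : ℝ)) | past X s]) =ᵐ[μ]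
      fun ω => (P s t (X s ω)).real B

/-- A kernel on `I ⊆ ℝ` is totally positive of order 2:
`det (P(xᵢ, Eⱼ)) ≥ 0` whenever `x₁ < x₂` and `E₁ < E₂`. -/
def IsTP2Kernel {I : Set ℝ} (P : Kernel I I) : Prop :=
  ∀ x₁ x₂ : I, x₁ < x₂ → ∀ E₁ E₂ : Set I, MeasurableSet E₁ → MeasurableSet E₂ →
    (∀ a ∈ E₁, ∀ b ∈ E₂, a < b) → P x₁ E₂ * P x₂ E₁ ≤ P x₁ E₁ * P x₂ E₂

/-- All the measures `P(x, dy)` have a density with respect to one σ-finite measure. -/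
def IsAbsContKernel {E : Type*} [MeasurableSpace E] (P : Kernel E E) : Prop :=
  ∃ ν : Measure E, SigmaFinite ν ∧ ∀ x, P x ≪ ν

/-- Every increment is independent of the history of the process (including the initial value). -/
def HasIndepIncr {Ω : Type*} [MeasurableSpace Ω] (X : ℝ≥0 → Ω → ℝ) (μ : Measure Ω) : Prop :=
  ∀ s t : ℝ≥0, s ≤ t →
    Indep (MeasurableSpace.comap (fun ω => X t ω - X s ω) inferInstance) (past X s) μ

/-- A law on `ℝ` has a log-concave density with respect to Lebesgue measure. -/
def HasLogConcaveDensity (ν : Measure ℝ) : Prop :=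
  ∃ p : ℝ → ℝ≥0, Measurable p ∧
    (∀ x y θ : ℝ, 0 < θ → θ < 1 →
      p x ^ θ * p y ^ (1 - θ) ≤ p (θ * x + (1 - θ) * y)) ∧
    ν = volume.withDensity (fun x => (p x : ℝ≥0∞))

/-- Log-concavity of a sequence: `p(k)² ≥ p(k-1) p(k+1)`, and the support of `p` has no gap. -/
def IsLogConcaveSeq (p : ℤ → ℝ) : Prop :=
  (∀ k, p (k - 1) * p (k + 1) ≤ p k ^ 2) ∧
    ∀ a b c : ℤ, a < b → b < c → p a ≠ 0 → p c ≠ 0 → p b ≠ 0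

/-- `(X, (Q_x)_{x ∈ I})` is a (time-homogeneous) one-dimensional diffusion on `I ⊆ ℝ`: a strong
Markov process with continuous paths, started from `x` under `Q_x`. The strong Markov property is
stated at finite stopping times of the natural filtration: for `A` in the σ-algebra of events prior
to `τ`, `Q_x(A, X_{τ+t} ∈ B) = E_x[1_A Q_{X_τ}(X_t ∈ B)]`. -/
structure IsDiffusion {Ω : Type*} [MeasurableSpace Ω] {I : Set ℝ} (X : ℝ≥0 → Ω → I)
    (Q : Kernel I Ω) : Prop where
  markovKernel : IsMarkovKernel Q
  measurable : ∀ t, Measurable (X t)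
  continuous_path : ∀ ω, Continuous (fun t => X t ω)
  start : ∀ x : I, ∀ᵐ ω ∂(Q x), X 0 ω = x
  strongMarkov : ∀ (τ : Ω → ℝ≥0)
    (hτ : IsStoppingTime (Filtration.natural X fun t => (measurable t).stronglyMeasurable)
      (fun ω => (τ ω : WithTop ℝ≥0)))
    (A : Set Ω), MeasurableSet[hτ.measurableSpace] A →
    ∀ (x : I) (t : ℝ≥0) (B : Set I), MeasurableSet B →
      Q x (A ∩ {ω | X (τ ω + t) ω ∈ B}) = ∫⁻ ω in A, Q (X (τ ω) ω) (X t ⁻¹' B) ∂(Q x)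

/-- The transition function `P_t(x, dy) = Q_x(X_t ∈ dy)`. -/
noncomputable def transition {Ω : Type*} [MeasurableSpace Ω] {I : Set ℝ} (X : ℝ≥0 → Ω → I)
    (Q : Kernel I Ω) (t : ℝ≥0) : Kernel I I :=
  Q.map (X t)

end SCM

/-! ### The four functions inequality on chains and products of chains. -/

namespace SCM

/-! Everything passes through the four functions (Ahlswede–Daykin) inequality for the law of the
vector `Y`. Put `g x = ∏ₖ fₖ(xₖ)` and choose a constant `c` with `φ + c ≥ 0`. For Borel sets `A < B`
apply the inequality to `1_{xᵢ∈A} (φ+c) g`, `1_{xᵢ∈B} g`, `1_{xᵢ∈A} g`, `1_{xᵢ∈B} (φ+c) g`. Its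
hypothesis holds because `g x * g y = g (x ⊓ y) * g (x ⊔ y)` and `φ` is monotone. The conclusion
says that under the law tilted by `g` the mean of `φ` given `Yᵢ ∈ A` is at most its mean given `Yᵢ ∈
B`. Shrinking `A` and `B` to points by Besicovitch differentiation yields the monotone version
(`FourFunctions.isSCMVector`).

The inequality holds for every s-finite measure on a chain, and it survives products,
log-supermodular densities and images under lattice homomorphisms. This settles the MTP₂ case. For
Markov processes no joint density is needed: the times are added one by one, and integrating out the
last coordinate only requires that `P s t x` and `P s t y`, `x < y`, be comparable in the likelihood
ratio order (`HasTransition.fourFunctions`).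

That order is then checked in each case. For TP₂ kernels it follows by differentiating the
inequality between sets. For independent increments it compares two translates of one log-concave
density. For diffusions TP₂ is the Karlin–McGregor argument: two independent copies started from `x
< y` must meet before they can be found in the reverse order, and after the meeting their futures
can be exchanged. -/

theorem ennreal_add_le_add_of_mul_le_mul {a b c d : ℝ≥0∞} (ha : a ≤ c) (hb : b ≤ c)
    (h : a * b ≤ c * d) : a + b ≤ c + d := by
  rcases eq_or_ne c ⊤ with rfl | hc
  · simp
  rcases eq_or_ne d ⊤ with rfl | hd
  · simp
  lift c to ℝ≥0 using hc
  lift d to ℝ≥0 using hd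
  lift a to ℝ≥0 using (ha.trans_lt ENNReal.coe_lt_top).ne
  lift b to ℝ≥0 using (hb.trans_lt ENNReal.coe_lt_top).ne
  norm_cast at *
  rcases eq_or_ne c 0 with rfl | hc0
  · simp_all
  have hcp : (0 : ℝ) < c := by positivity
  rw [← NNReal.coe_le_coe] at *
  push_cast at *
  -- Expanding `(c - a)(c - b) ≥ 0` gives `c(a + b) ≤ c² + ab ≤ c(c + d)`; then `c > 0` cancels.
  nlinarith [mul_nonneg (sub_nonneg.2 ha) (sub_nonneg.2 hb)]

/-- The four functions property of a measure on a lattice. -/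
def FourFunctions {α : Type*} [MeasurableSpace α] [Lattice α] (m : Measure α) : Prop :=
  ∀ f₁ f₂ f₃ f₄ : α → ℝ≥0∞, Measurable f₁ → Measurable f₂ → Measurable f₃ → Measurable f₄ →
    (∀ x y, f₁ x * f₂ y ≤ f₃ (x ⊓ y) * f₄ (x ⊔ y)) →
    (∫⁻ x, f₁ x ∂m) * (∫⁻ x, f₂ x ∂m) ≤ (∫⁻ x, f₃ x ∂m) * (∫⁻ x, f₄ x ∂m)

section OneDim

variable {E : Type*} [MeasurableSpace E] [LinearOrder E]

/-- The four functions theorem on a linearly ordered measure space. -/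
theorem fourFunctions_of_linearOrder (m : Measure E) [SFinite m] : FourFunctions m := by
  intro f₁ f₂ f₃ f₄ h₁ h₂ h₃ h₄ h
  -- Symmetrised in `(x, y)`, the inequality holds pointwise, and both sides integrate to twice the
  -- products of integrals.
  have key : ∀ x y, f₁ x * f₂ y + f₁ y * f₂ x ≤ f₃ x * f₄ y + f₃ y * f₄ x := by
    have main : ∀ x y, x ≤ y → f₁ x * f₂ y + f₁ y * f₂ x ≤ f₃ x * f₄ y + f₃ y * f₄ x := by
      intro x y hxy
      refine ennreal_add_le_add_of_mul_le_mul ?_ ?_ ?_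
      · simpa [hxy] using h x y
      · simpa [hxy] using h y x
      · calc f₁ x * f₂ y * (f₁ y * f₂ x) = (f₁ x * f₂ x) * (f₁ y * f₂ y) := by ring
          _ ≤ (f₃ x * f₄ x) * (f₃ y * f₄ y) := by
            refine mul_le_mul' ?_ ?_
            · simpa using h x x
            · simpa using h y y
          _ = _ := by ring
    intro x y
    rcases le_total x y with hxy | hxy
    · exact main x y hxy
    · rw [add_comm, add_comm (f₃ x * f₄ y)]
      exact main y x hxy
  have sym : ∀ f g : E → ℝ≥0∞, Measurable f → Measurable g →
      ∫⁻ x, ∫⁻ y, (f x * g y + f y * g x) ∂m ∂m = 2 * ((∫⁻ x, f x ∂m) * ∫⁻ x, g x ∂m) := by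
    intro f g hf hg
    have : ∀ x, ∫⁻ y, (f x * g y + f y * g x) ∂m
        = f x * (∫⁻ y, g y ∂m) + (∫⁻ y, f y ∂m) * g x := by
      intro x
      rw [lintegral_add_left (by fun_prop), lintegral_const_mul _ hg, lintegral_mul_const _ hf]
    simp_rw [this]
    rw [lintegral_add_left (by fun_prop), lintegral_const_mul _ hg, lintegral_mul_const _ hf]
    ring
  have := lintegral_mono (μ := m) fun x => lintegral_mono (μ := m) fun y => key x y
  rw [sym f₁ f₂ h₁ h₂, sym f₃ f₄ h₃ h₄] at this
  exact (ENNReal.mul_le_mul_iff_right (by simp) (by simp)).1 this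

/-- `m₁` is smaller than `m₂` in the likelihood ratio order. -/
def LikelihoodRatioLE (m₁ m₂ : Measure E) : Prop :=
  ∃ (ν : Measure E) (p₁ p₂ : E → ℝ≥0∞), SFinite ν ∧ Measurable p₁ ∧ Measurable p₂ ∧
    m₁ = ν.withDensity p₁ ∧ m₂ = ν.withDensity p₂ ∧
    ∀ x y, x < y → p₁ y * p₂ x ≤ p₁ x * p₂ y

/-- The two densities are absorbed into the four functions: the likelihood ratio order says exactly
that `p₁ x * p₂ y ≤ p₁ (x ⊓ y) * p₂ (x ⊔ y)`. -/
theorem LikelihoodRatioLE.lintegral_mul_le {m₁ m₂ : Measure E} (hm : LikelihoodRatioLE m₁ m₂)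
    {f₁ f₂ f₃ f₄ : E → ℝ≥0∞} (h₁ : Measurable f₁) (h₂ : Measurable f₂) (h₃ : Measurable f₃)
    (h₄ : Measurable f₄) (h : ∀ x y, f₁ x * f₂ y ≤ f₃ (x ⊓ y) * f₄ (x ⊔ y)) :
    (∫⁻ x, f₁ x ∂m₁) * (∫⁻ x, f₂ x ∂m₂) ≤ (∫⁻ x, f₃ x ∂m₁) * (∫⁻ x, f₄ x ∂m₂) := by
  obtain ⟨ν, p₁, p₂, hν, hp₁, hp₂, rfl, rfl, hp⟩ := hm
  simp only [lintegral_withDensity_eq_lintegral_mul ν hp₁ h₁,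
    lintegral_withDensity_eq_lintegral_mul ν hp₁ h₃,
    lintegral_withDensity_eq_lintegral_mul ν hp₂ h₂,
    lintegral_withDensity_eq_lintegral_mul ν hp₂ h₄]
  refine fourFunctions_of_linearOrder ν _ _ _ _ (hp₁.mul h₁) (hp₂.mul h₂) (hp₁.mul h₃)
    (hp₂.mul h₄) fun x y => ?_
  have hpp : p₁ x * p₂ y ≤ p₁ (x ⊓ y) * p₂ (x ⊔ y) := by
    rcases le_or_gt x y with hxy | hxy
    · simp [hxy]
    · simpa [hxy.le] using hp y x hxy
  calc (p₁ * f₁) x * (p₂ * f₂) y = (p₁ x * p₂ y) * (f₁ x * f₂ y) := by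
        simp only [Pi.mul_apply]; ring
    _ ≤ (p₁ (x ⊓ y) * p₂ (x ⊔ y)) * (f₃ (x ⊓ y) * f₄ (x ⊔ y)) :=
        mul_le_mul' hpp (h x y)
    _ = _ := by simp only [Pi.mul_apply]; ring

end OneDim

theorem FourFunctions.withDensity {α : Type*} [MeasurableSpace α] [Lattice α] {m : Measure α}
    (hm : FourFunctions m) {p : α → ℝ≥0∞} (hp : Measurable p)
    (h : ∀ x y, p x * p y ≤ p (x ⊓ y) * p (x ⊔ y)) : FourFunctions (m.withDensity p) := by
  intro f₁ f₂ f₃ f₄ h₁ h₂ h₃ h₄ hf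
  simp only [lintegral_withDensity_eq_lintegral_mul m hp h₁,
    lintegral_withDensity_eq_lintegral_mul m hp h₃,
    lintegral_withDensity_eq_lintegral_mul m hp h₂,
    lintegral_withDensity_eq_lintegral_mul m hp h₄]
  refine hm _ _ _ _ (hp.mul h₁) (hp.mul h₂) (hp.mul h₃) (hp.mul h₄) fun x y => ?_
  calc (p * f₁) x * (p * f₂) y = (p x * p y) * (f₁ x * f₂ y) := by
        simp only [Pi.mul_apply]; ring
    _ ≤ (p (x ⊓ y) * p (x ⊔ y)) * (f₃ (x ⊓ y) * f₄ (x ⊔ y)) :=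
        mul_le_mul' (h x y) (hf x y)
    _ = _ := by simp only [Pi.mul_apply]; ring

theorem FourFunctions.map {α β : Type*} [MeasurableSpace α] [Lattice α] [MeasurableSpace β]
    [Lattice β] {m : Measure α} (hm : FourFunctions m) {g : α → β} (hg : Measurable g)
    (hinf : ∀ x y, g (x ⊓ y) = g x ⊓ g y) (hsup : ∀ x y, g (x ⊔ y) = g x ⊔ g y) :
    FourFunctions (m.map g) := by
  intro f₁ f₂ f₃ f₄ h₁ h₂ h₃ h₄ hf
  rw [lintegral_map h₁ hg, lintegral_map h₂ hg, lintegral_map h₃ hg, lintegral_map h₄ hg]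
  refine hm _ _ _ _ (h₁.comp hg) (h₂.comp hg) (h₃.comp hg) (h₄.comp hg) fun x y => ?_
  simpa [hinf, hsup] using hf (g x) (g y)

/-- By Fubini: for fixed first coordinates, the property of `m'` shows that the four partial
integrals again satisfy the hypothesis, now on `α`. -/
theorem FourFunctions.prod {α β : Type*} [MeasurableSpace α] [Lattice α] [MeasurableSpace β]
    [Lattice β] {m : Measure α} {m' : Measure β} [SFinite m'] (hm : FourFunctions m)
    (hm' : FourFunctions m') : FourFunctions (m.prod m') := by
  intro f₁ f₂ f₃ f₄ h₁ h₂ h₃ h₄ hf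
  rw [lintegral_prod _ h₁.aemeasurable, lintegral_prod _ h₂.aemeasurable,
    lintegral_prod _ h₃.aemeasurable, lintegral_prod _ h₄.aemeasurable]
  refine hm _ _ _ _ h₁.lintegral_prod_right' h₂.lintegral_prod_right' h₃.lintegral_prod_right'
    h₄.lintegral_prod_right' fun x y => ?_
  exact hm' _ _ _ _ (by fun_prop) (by fun_prop) (by fun_prop) (by fun_prop)
    fun x' y' => hf (x, x') (y, y')

theorem fourFunctions_pi {E : Type*} [MeasurableSpace E] [LinearOrder E] :
    ∀ {n : ℕ} (ν : Fin n → Measure E) [∀ k, SigmaFinite (ν k)], FourFunctions (Measure.pi ν)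
  | 0, ν, _ => by
    intro f₁ f₂ f₃ f₄ h₁ h₂ h₃ h₄ hf
    rw [Measure.pi_of_empty ν (fun k => k.elim0)]
    simp only [lintegral_dirac' _ h₁, lintegral_dirac' _ h₂,
      lintegral_dirac' _ h₃, lintegral_dirac' _ h₄]
    exact (hf _ _).trans_eq (by congr 2 <;> exact Subsingleton.elim _ _)
  | n + 1, ν, _ => by
    have ih := fourFunctions_pi (fun k : Fin n => ν ((0 : Fin (n + 1)).succAbove k))
    have h := (fourFunctions_of_linearOrder (ν 0)).prod ih
    have hp := (measurePreserving_piFinSuccAbove ν 0).symm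
    rw [← hp.map_eq]
    refine h.map hp.measurable ?_ ?_
    · rintro ⟨a, x⟩ ⟨b, y⟩
      ext k
      refine Fin.cases ?_ (fun j => ?_) k <;> simp [MeasurableEquiv.piFinSuccAbove]
    · rintro ⟨a, x⟩ ⟨b, y⟩
      ext k
      refine Fin.cases ?_ (fun j => ?_) k <;> simp [MeasurableEquiv.piFinSuccAbove]

theorem IsMTP2Vector.fourFunctions {Ω : Type*} [MeasurableSpace Ω] {n : ℕ} {Y : Fin n → Ω → ℝ}
    {μ : Measure Ω} (h : IsMTP2Vector Y μ) : FourFunctions (μ.map fun ω k => Y k ω) := by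
  obtain ⟨ν, hν, p, hp, hmtp, heq⟩ := h
  rw [heq]
  refine (fourFunctions_pi ν).withDensity (by fun_prop) fun x y => ?_
  exact_mod_cast hmtp x y

/-! ### Monotone densities, and strong conditional monotonicity from four functions. -/

/-- If the averages of `ρ` with respect to `q` are monotone on ordered sets, then its density
has a monotone version. -/
theorem monotoneOn_rnDeriv_of_mul_le_mul (ρ q : Measure ℝ) [IsFiniteMeasure ρ]
    [IsFiniteMeasure q]
    (h : ∀ A B : Set ℝ, MeasurableSet A → MeasurableSet B → (∀ a ∈ A, ∀ b ∈ B, a < b) →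
      ρ A * q B ≤ q A * ρ B) :
    ∃ S : Set ℝ, (∀ᵐ x ∂q, x ∈ S) ∧ MonotoneOn (ρ.rnDeriv q) S := by
  -- The points where the ratios over balls converge to the derivative and which lie in the support
  -- of `q`, so that no ratio is `0 / 0`.
  refine ⟨{x | Filter.Tendsto (fun r => ρ (Metric.closedBall x r) / q (Metric.closedBall x r))
    (nhdsWithin 0 (Ioi 0)) (nhds (ρ.rnDeriv q x)) ∧
      ∀ r > 0, q (Metric.closedBall x r) ≠ 0}, ?_, ?_⟩
  · have h1 := Besicovitch.ae_tendsto_rnDeriv ρ q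
    have h2 : ∀ᵐ x ∂q, x ∈ q.support := Measure.support_mem_ae
    filter_upwards [h1, h2] with x hx hx2
    refine ⟨hx, fun r hr => ?_⟩
    exact ((Measure.mem_support_iff_forall x).1 hx2 _ (Metric.closedBall_mem_nhds x hr)).ne'
  · intro x hx y hy hxy
    rcases hxy.eq_or_lt with rfl | hxy
    · exact le_rfl
    refine le_of_tendsto_of_tendsto hx.1 hy.1 ?_
    -- Radii below a third of the distance keep the two closed balls strictly ordered.
    have hpos : (0 : ℝ) < (y - x) / 3 := by linarith
    filter_upwards [Ioo_mem_nhdsGT hpos] with r hr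
    rw [ENNReal.div_le_iff (hx.2 r hr.1) (measure_ne_top _ _), mul_comm, ← mul_div_assoc,
      ENNReal.le_div_iff_mul_le (Or.inl (hy.2 r hr.1)) (Or.inl (measure_ne_top _ _))]
    refine h _ _ measurableSet_closedBall measurableSet_closedBall fun a ha b hb => ?_
    rw [Real.closedBall_eq_Icc] at ha hb
    have := ha.2
    have := hb.1
    have := hr.2
    linarith

theorem exists_monotone_density (ρ q : Measure ℝ) [IsFiniteMeasure ρ] [IsFiniteMeasure q]
    {C : ℝ≥0} (hle : ρ ≤ C • q)
    (h : ∀ A B : Set ℝ, MeasurableSet A → MeasurableSet B → (∀ a ∈ A, ∀ b ∈ B, a < b) →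
      ρ A * q B ≤ q A * ρ B) :
    ∃ K : ℝ → ℝ, Monotone K ∧ (∀ x, 0 ≤ K x ∧ K x ≤ C) ∧
      ρ = q.withDensity (fun x => ENNReal.ofReal (K x)) := by
  have hac : ρ ≪ q := (Measure.absolutelyContinuous_of_le hle).trans
    (Measure.smul_absolutelyContinuous)
  obtain ⟨S, hS, hmono⟩ := monotoneOn_rnDeriv_of_mul_le_mul ρ q h
  have hbd : ∀ᵐ x ∂q, ρ.rnDeriv q x ≤ C := by
    refine ae_le_of_forall_setLIntegral_le_of_sigmaFinite (Measure.measurable_rnDeriv _ _)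
      fun s hs _ => ?_
    rw [Measure.setLIntegral_rnDeriv hac, lintegral_const]
    simpa using hle s
  set T := S ∩ {x | ρ.rnDeriv q x ≤ C}
  have hT : ∀ᵐ x ∂q, x ∈ T := by filter_upwards [hS, hbd] with x h1 h2 using ⟨h1, h2⟩
  have hTm : MonotoneOn (fun x => (ρ.rnDeriv q x).toReal) T := fun x hx y hy hxy =>
    ENNReal.toReal_mono (ne_top_of_le_ne_top ENNReal.coe_ne_top hy.2) (hmono hx.1 hy.1 hxy)
  obtain ⟨K, hK, hKT⟩ := hTm.exists_monotone_extension
    ⟨0, by rintro _ ⟨x, -, rfl⟩; exact ENNReal.toReal_nonneg⟩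
    ⟨C, by rintro _ ⟨x, hx, rfl⟩; exact ENNReal.toReal_le_coe_of_le_coe hx.2⟩
  -- The monotone extension is controlled only on `T`; clipping to `[0, C]` bounds it everywhere and
  -- changes nothing on `T`.
  refine ⟨fun x => max 0 (min (K x) C), fun x y hxy => max_le_max le_rfl (min_le_min (hK hxy) le_rfl), fun x =>
    ⟨le_max_left _ _, max_le C.2 (min_le_right _ _)⟩, ?_⟩
  rw [← Measure.withDensity_rnDeriv_eq ρ q hac]
  refine withDensity_congr_ae ?_
  filter_upwards [hT] with x hx
  have hx2 : (ρ.rnDeriv q x).toReal ≤ C := ENNReal.toReal_le_coe_of_le_coe hx.2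
  rw [← hKT hx, min_eq_left hx2, max_eq_right ENNReal.toReal_nonneg,
    ENNReal.ofReal_toReal (ne_top_of_le_ne_top ENNReal.coe_ne_top hx.2)]

/-- The marginals on coordinate `i` of the law weighted by `(φ + c) g` and by `g` are `ρ` and `q`.
The required ratio is `dρ/dq - c`, and four functions applied with indicators of ordered sets makes
this density monotone. -/
theorem FourFunctions.isSCMVector {Ω : Type*} [MeasurableSpace Ω] {n : ℕ} {Y : Fin n → Ω → ℝ}
    {μ : Measure Ω} [IsProbabilityMeasure μ] (hY : ∀ k, Measurable (Y k))
    (hm : FourFunctions (μ.map fun ω k => Y k ω)) : IsSCMVector Y μ := by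
  intro i f hf hfpos hint φ hφ
  have hYm : Measurable fun ω k => Y k ω := measurable_pi_lambda _ hY
  set c : ℝ := ‖φ‖
  have hφc : ∀ x, 0 ≤ φ x + c := fun x => by
    have := neg_abs_le (φ x); have := φ.norm_coe_le_norm x; rw [Real.norm_eq_abs] at this; linarith
  have hφc2 : ∀ x, φ x + c ≤ 2 * c := fun x => by
    have := le_abs_self (φ x); have := φ.norm_coe_le_norm x; rw [Real.norm_eq_abs] at this; linarith
  set g : (Fin n → ℝ) → ℝ := fun x => ∏ k, f k (x k)
  have hgc : Continuous g := by fun_prop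
  have hg0 : ∀ x, 0 < g x := fun x => Finset.prod_pos fun k _ => hfpos k _
  have hgm : ∀ x y, g x * g y = g (x ⊓ y) * g (x ⊔ y) := by
    intro x y
    simp only [g, ← Finset.prod_mul_distrib, Pi.inf_apply, Pi.sup_apply]
    refine Finset.prod_congr rfl fun k _ => ?_
    rcases le_total (x k) (y k) with h | h
    · simp [h]
    · simp [h, mul_comm]
  set ψ : (Fin n → ℝ) → ℝ := fun x => (φ x + c) * g x
  have hψc : Continuous ψ := by fun_prop
  set G : (Fin n → ℝ) → ℝ≥0∞ := fun x => ENNReal.ofReal (g x)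
  set Ψ : (Fin n → ℝ) → ℝ≥0∞ := fun x => ENNReal.ofReal (ψ x)
  have hG : Measurable G := hgc.measurable.ennreal_ofReal
  have hΨ : Measurable Ψ := hψc.measurable.ennreal_ofReal
  set ν := μ.map fun ω k => Y k ω
  have hi : Measurable fun x : Fin n → ℝ => x i := measurable_pi_apply i
  set q := (ν.withDensity G).map fun x => x i
  set ρ := (ν.withDensity Ψ).map fun x => x i
  have hqB : ∀ B, MeasurableSet B → q B = ∫⁻ x, ((fun x => x i) ⁻¹' B).indicator G x ∂ν := by
    intro B hB
    rw [Measure.map_apply hi hB, withDensity_apply _ (hi hB), lintegral_indicator (hi hB)]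
  have hρB : ∀ B, MeasurableSet B → ρ B = ∫⁻ x, ((fun x => x i) ⁻¹' B).indicator Ψ x ∂ν := by
    intro B hB
    rw [Measure.map_apply hi hB, withDensity_apply _ (hi hB), lintegral_indicator (hi hB)]
  have hΨG : ∀ x, Ψ x ≤ (2 * ‖φ‖₊ : ℝ≥0) * G x := by
    intro x
    have : ((2 * ‖φ‖₊ : ℝ≥0) : ℝ≥0∞) = ENNReal.ofReal (2 * c) := by
      rw [← ENNReal.ofReal_coe_nnreal]; simp [c]
    rw [this, ← ENNReal.ofReal_mul (by positivity)]
    exact ENNReal.ofReal_le_ofReal (mul_le_mul_of_nonneg_right (hφc2 x) (hg0 x).le)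
  have hle : ρ ≤ (2 * ‖φ‖₊ : ℝ≥0) • q := by
    refine Measure.le_iff.2 fun B hB => ?_
    rw [Measure.smul_apply, hqB B hB, hρB B hB, ENNReal.smul_def, smul_eq_mul,
      ← lintegral_const_mul _ (hG.indicator (hi hB))]
    refine lintegral_mono fun x => ?_
    by_cases hx : x ∈ (fun x : Fin n → ℝ => x i) ⁻¹' B
    · simpa [hx] using hΨG x
    · simp [hx]
  have hqfin : IsFiniteMeasure q := by
    refine ⟨?_⟩
    rw [hqB _ MeasurableSet.univ]
    simp only [preimage_univ, indicator_univ]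
    rw [lintegral_map hG hYm]
    exact hint.lintegral_lt_top
  have hρfin : IsFiniteMeasure ρ := by
    refine ⟨(hle univ).trans_lt ?_⟩
    rw [Measure.smul_apply, ENNReal.smul_def]
    exact ENNReal.mul_lt_top ENNReal.coe_lt_top (measure_lt_top _ _)
  have hcross : ∀ A B : Set ℝ, MeasurableSet A → MeasurableSet B → (∀ a ∈ A, ∀ b ∈ B, a < b) →
      ρ A * q B ≤ q A * ρ B := by
    intro A B hA hB hAB
    rw [hqB A hA, hqB B hB, hρB A hA, hρB B hB]
    refine hm _ _ _ _ (hΨ.indicator (hi hA)) (hG.indicator (hi hB)) (hG.indicator (hi hA))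
      (hΨ.indicator (hi hB)) fun x y => ?_
    by_cases hx : x i ∈ A
    swap
    · simp [hx]
    by_cases hy : y i ∈ B
    swap
    · simp [hy]
    have hlt := hAB _ hx _ hy
    have h1 : (x ⊓ y) i ∈ A := by simpa [hlt.le] using hx
    have h2 : (x ⊔ y) i ∈ B := by simpa [hlt.le] using hy
    rw [indicator_of_mem (show x ∈ (fun x : Fin n → ℝ => x i) ⁻¹' A from hx),
      indicator_of_mem (show y ∈ (fun x : Fin n → ℝ => x i) ⁻¹' B from hy),
      indicator_of_mem (show x ⊓ y ∈ (fun x : Fin n → ℝ => x i) ⁻¹' A from h1),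
      indicator_of_mem (show x ⊔ y ∈ (fun x : Fin n → ℝ => x i) ⁻¹' B from h2)]
    simp only [Ψ, G, ψ]
    rw [← ENNReal.ofReal_mul (mul_nonneg (hφc _) (hg0 _).le), ← ENNReal.ofReal_mul (hg0 _).le]
    refine ENNReal.ofReal_le_ofReal ?_
    calc (φ x + c) * g x * g y = (φ x + c) * (g (x ⊓ y) * g (x ⊔ y)) := by rw [← hgm]; ring
      -- The factor `φ + c` is moved from `x` to `x ⊔ y`, the only use of the monotonicity of `φ`.
      _ ≤ (φ (x ⊔ y) + c) * (g (x ⊓ y) * g (x ⊔ y)) := by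
        refine mul_le_mul_of_nonneg_right ?_ (mul_nonneg (hg0 _).le (hg0 _).le)
        have := hφ (le_sup_left : x ≤ x ⊔ y)
        linarith
      _ = _ := by ring
  obtain ⟨K, hK, hKb, hρq⟩ := exists_monotone_density ρ q hle hcross
  have hKm : Measurable K := hK.measurable
  set y : Ω → (Fin n → ℝ) := fun ω k => Y k ω
  have hint' : Integrable (fun ω => g (y ω)) μ := hint
  have hφy : Measurable fun ω => φ (y ω) := φ.continuous.measurable.comp hYm
  have hφint : Integrable (fun ω => φ (y ω) * g (y ω)) μ :=
    hint'.bdd_mul hφy.aestronglyMeasurable (c := c) (by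
      filter_upwards with ω using φ.norm_coe_le_norm _)
  have hK0int : Integrable (fun ω => K (Y i ω) * g (y ω)) μ :=
    hint'.bdd_mul (hKm.comp (hY i)).aestronglyMeasurable (c := (2 * ‖φ‖₊ : ℝ≥0)) (by
      filter_upwards with ω
      rw [Real.norm_eq_abs, abs_of_nonneg (hKb _).1]
      exact (hKb _).2)
  have hKint : Integrable (fun ω => (K (Y i ω) - c) * g (y ω)) μ := by
    simp only [sub_mul]
    exact hK0int.sub (hint'.const_mul c)
  have hset : ∀ B, MeasurableSet B →
      ∫ ω in Y i ⁻¹' B, (φ (y ω) + c) * g (y ω) ∂μ = ∫ ω in Y i ⁻¹' B, K (Y i ω) * g (y ω) ∂μ := by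
    intro B hB
    rw [integral_eq_lintegral_of_nonneg_ae, integral_eq_lintegral_of_nonneg_ae]
    · congr 1
      have h1 : ∫⁻ ω in Y i ⁻¹' B, ENNReal.ofReal ((φ (y ω) + c) * g (y ω)) ∂μ = ρ B := by
        rw [Measure.map_apply hi hB, withDensity_apply _ (hi hB),
          setLIntegral_map (hi hB) hΨ hYm]
        rfl
      rw [h1, hρq, withDensity_apply _ hB, setLIntegral_map hB (by fun_prop) hi,
        setLIntegral_withDensity_eq_setLIntegral_mul _ hG (by fun_prop) (hi hB),
        setLIntegral_map (hi hB) (by fun_prop) hYm]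
      refine lintegral_congr fun ω => ?_
      rw [ENNReal.ofReal_mul (hKb _).1, mul_comm]
      rfl
    · filter_upwards with ω using mul_nonneg (hKb _).1 (hg0 _).le
    · exact hK0int.1.restrict
    · filter_upwards with ω using mul_nonneg (hφc _) (hg0 _).le
    · exact (hψc.measurable.comp hYm).aestronglyMeasurable
  have hm0 : MeasurableSpace.comap (Y i) inferInstance ≤ (inferInstance : MeasurableSpace Ω) :=
    (hY i).comap_le
  set mi : MeasurableSpace Ω := MeasurableSpace.comap (Y i) inferInstance
  have hYi : Measurable[mi] (Y i) := comap_measurable _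
  have hKi : StronglyMeasurable[mi] fun ω => K (Y i ω) - c :=
    ((hKm.comp hYi).sub_const c).stronglyMeasurable
  have hG' : μ[fun ω => (K (Y i ω) - c) * g (y ω) | mi] =ᵐ[μ]
      μ[fun ω => φ (y ω) * g (y ω) | mi] := by
    refine ae_eq_condExp_of_forall_setIntegral_eq hm0 hφint
      (fun s _ _ => integrable_condExp.integrableOn) ?_
      stronglyMeasurable_condExp.aestronglyMeasurable
    rintro _ ⟨B, hB, rfl⟩ -
    rw [setIntegral_condExp hm0 hKint ⟨B, hB, rfl⟩]
    have h1 := hset B hB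
    simp only [add_mul] at h1
    rw [integral_add hφint.integrableOn (hint'.const_mul c).integrableOn] at h1
    simp only [sub_mul]
    rw [integral_sub hK0int.integrableOn (hint'.const_mul c).integrableOn]
    linarith
  have hpull : μ[fun ω => (K (Y i ω) - c) * g (y ω) | mi] =ᵐ[μ]
      fun ω => (K (Y i ω) - c) * (μ[fun ω => g (y ω) | mi]) ω :=
    condExp_mul_of_stronglyMeasurable_left hKi hKint hint'
  -- The quotient needs a nonzero denominator: on the event where it is nonpositive the strictly
  -- positive `g` would have integral at most `0`, so that event is null.
  have hpos : ∀ᵐ ω ∂μ, 0 < (μ[fun ω => g (y ω) | mi]) ω := by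
    have hs : MeasurableSet[mi] {ω | (μ[fun ω => g (y ω) | mi]) ω ≤ 0} :=
      measurableSet_le stronglyMeasurable_condExp.measurable measurable_const
    have h0 : ∫ ω in {ω | (μ[fun ω => g (y ω) | mi]) ω ≤ 0}, g (y ω) ∂μ ≤ 0 := by
      rw [← setIntegral_condExp hm0 hint' hs]
      exact setIntegral_nonpos (hm0 _ hs) fun ω hω => hω
    have h1 : μ {ω | (μ[fun ω => g (y ω) | mi]) ω ≤ 0} = 0 := by
      by_contra hne
      refine absurd h0 (not_le.2 ?_)
      rw [setIntegral_pos_iff_support_of_nonneg_ae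
        (by filter_upwards with ω using (hg0 _).le) hint'.integrableOn]
      have : Function.support (fun ω => g (y ω)) = univ := by
        ext ω; simp [(hg0 _).ne']
      rw [this, univ_inter]
      exact pos_iff_ne_zero.2 hne
    rw [ae_iff]
    simpa only [not_lt] using h1
  refine ⟨fun z => K z - c, fun a b hab => sub_le_sub_right (hK hab) c, ?_⟩
  filter_upwards [hG', hpull, hpos] with ω h1 h2 h3
  rw [eq_div_iff h3.ne']
  exact h2.symm.trans h1

/-! ### Markov processes with kernels monotone in the likelihood ratio order. -/

section Chain

variable {Ω E : Type*} [MeasurableSpace Ω] [MeasurableSpace E]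

/-- The Markov property in integrated form. -/
def HasTransition (X : ℝ≥0 → Ω → E) (P : ℝ≥0 → ℝ≥0 → Kernel E E) (μ : Measure Ω) : Prop :=
  ∀ s t, s < t → ∀ A, MeasurableSet[past X s] A → ∀ B, MeasurableSet B →
    μ (A ∩ X t ⁻¹' B) = ∫⁻ ω in A, P s t (X s ω) B ∂μ

theorem past_le {X : ℝ≥0 → Ω → E} (hX : ∀ t, Measurable (X t)) (s : ℝ≥0) :
    past X s ≤ (inferInstance : MeasurableSpace Ω) :=
  iSup₂_le fun u _ => (hX u).comap_le

theorem measurable_past {Ω E : Type*} [MeasurableSpace E] (X : ℝ≥0 → Ω → E) {u s : ℝ≥0} (h : u ≤ s) : Measurable[past X s] (X u) :=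
  (comap_measurable (X u)).mono (le_iSup₂_of_le u h le_rfl) le_rfl

theorem HasTransition.lintegral_eq {α : Type*} [MeasurableSpace α] {X : ℝ≥0 → Ω → E}
    {P : ℝ≥0 → ℝ≥0 → Kernel E E} {μ : Measure Ω} [IsFiniteMeasure μ] (hX : ∀ t, Measurable (X t))
    (h : HasTransition X P μ) {s t : ℝ≥0} (hst : s < t) [IsMarkovKernel (P s t)] {U : Ω → α}
    (hU : Measurable[past X s] U) {f : α × E → ℝ≥0∞} (hf : Measurable f) :
    ∫⁻ ω, f (U ω, X t ω) ∂μ = ∫⁻ ω, ∫⁻ y, f (U ω, y) ∂(P s t (X s ω)) ∂μ := by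
  have hU' : Measurable U := hU.mono (past_le hX s) le_rfl
  have hmap : Measurable (Prod.map U (id : E → E)) := hU'.prodMap measurable_id
  have key : μ.map (fun ω => (U ω, X t ω)) =
      (μ ⊗ₘ (P s t).comap (X s) (hX s)).map (Prod.map U id) := by
    refine Measure.ext_prod fun {A B} hA hB => ?_
    rw [Measure.map_apply (hU'.prodMk (hX t)) (hA.prod hB), Measure.map_apply hmap (hA.prod hB),
      Measure.compProd_apply (hmap (hA.prod hB))]
    have h1 := h s t hst (U ⁻¹' A) (hU hA) B hB
    rw [← lintegral_indicator (hU' hA)] at h1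
    refine h1.trans (lintegral_congr fun ω => ?_)
    by_cases hω : U ω ∈ A
    · rw [indicator_of_mem (show ω ∈ U ⁻¹' A from hω)]
      simp only [Kernel.comap_apply]
      congr 1
      ext y; simp [hω]
    · rw [indicator_of_notMem (show ω ∉ U ⁻¹' A from hω)]
      simp [preimage, hω]
  rw [← lintegral_map hf (hU'.prodMk (hX t)), key, lintegral_map hf hmap]
  exact Measure.lintegral_compProd (hf.comp hmap)

/-- Induction on the number of times. Integrating the last coordinate against `P s r` started from
the previous one turns the four functions into four functions of the earlier coordinates. These
inherit the hypothesis from the likelihood ratio order, and the induction hypothesis applies. -/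
theorem HasTransition.fourFunctions [LinearOrder E] {X : ℝ≥0 → Ω → E}
    {P : ℝ≥0 → ℝ≥0 → Kernel E E} {μ : Measure Ω} [IsFiniteMeasure μ] (hX : ∀ t, Measurable (X t))
    (hP : ∀ s t, s < t → IsMarkovKernel (P s t)) (h : HasTransition X P μ)
    (hlr : ∀ s t, s < t → ∀ x y, x < y → LikelihoodRatioLE (P s t x) (P s t y)) :
    ∀ {n : ℕ} (t : Fin (n + 1) → ℝ≥0), StrictMono t →
      FourFunctions (μ.map fun ω k => X (t k) ω)
  | 0, t, _ => by
    have h0 := fourFunctions_of_linearOrder (μ.map (X (t 0)))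
    have hc : Measurable fun (x : E) (_ : Fin 1) => x := by fun_prop
    have := h0.map hc (fun _ _ => rfl) (fun _ _ => rfl)
    rw [Measure.map_map hc (hX _)] at this
    convert this using 2
    ext ω k
    rw [show k = 0 from Fin.fin_one_eq_zero k]
    rfl
  | n + 1, t, ht => by
    have ih := HasTransition.fourFunctions hX hP h hlr (fun k : Fin (n + 1) => t k.castSucc)
      (ht.comp Fin.strictMono_castSucc)
    set s := t (Fin.last n).castSucc
    set r := t (Fin.last (n + 1))
    have hsr : s < r := ht (Fin.castSucc_lt_last _)
    have := hP s r hsr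
    set J : (Fin (n + 1) → E) × E → (Fin (n + 2) → E) :=
      fun z => Fin.snoc (α := fun _ => E) z.1 z.2
    have hJ : Measurable J := by
      refine measurable_pi_lambda _ fun k => ?_
      refine Fin.lastCases ?_ (fun j => ?_) k
      · simpa [J] using measurable_snd
      · simp only [J, Fin.snoc_castSucc]; fun_prop
    have hJinf : ∀ x x' : Fin (n + 1) → E, ∀ y y' : E,
        J (x, y) ⊓ J (x', y') = J (x ⊓ x', y ⊓ y') := by
      intro x x' y y'
      ext k
      refine Fin.lastCases ?_ (fun j => ?_) k <;> simp [J]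
    have hJsup : ∀ x x' : Fin (n + 1) → E, ∀ y y' : E,
        J (x, y) ⊔ J (x', y') = J (x ⊔ x', y ⊔ y') := by
      intro x x' y y'
      ext k
      refine Fin.lastCases ?_ (fun j => ?_) k <;> simp [J]
    set U : Ω → (Fin (n + 1) → E) := fun ω k => X (t k.castSucc) ω
    have hU : Measurable[past X s] U := (@measurable_pi_iff _ _ _ (past X s) _ _).2 fun k =>
      measurable_past X (ht.monotone (Fin.castSucc_le_castSucc_iff.2 (Fin.le_last k)))
    have hUm : Measurable U := hU.mono (past_le hX s) le_rfl
    have hV : (fun ω k => X (t k) ω) = fun ω => J (U ω, X r ω) := by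
      ext ω k
      refine Fin.lastCases ?_ (fun j => ?_) k <;> simp [J, U, r]
    have hVm : Measurable fun ω (k : Fin (n + 2)) => X (t k) ω := measurable_pi_lambda _ fun k => hX _
    have hint : ∀ f : (Fin (n + 2) → E) → ℝ≥0∞, Measurable f →
        ∫⁻ x, f x ∂(μ.map fun ω k => X (t k) ω) =
          ∫⁻ x, ∫⁻ y, f (J (x, y)) ∂(P s r (x (Fin.last n))) ∂(μ.map U) := by
      intro f hf
      have hm : Measurable fun x : Fin (n + 1) → E =>
          ∫⁻ y, f (J (x, y)) ∂(P s r (x (Fin.last n))) :=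
        (hf.comp hJ).lintegral_kernel_prod_right'
          (κ := (P s r).comap (fun x : Fin (n + 1) → E => x (Fin.last n)) (by fun_prop))
      rw [lintegral_map hf hVm, lintegral_map hm hUm]
      have := h.lintegral_eq hX hsr hU (hf.comp hJ)
      simp only [Function.comp_apply] at this
      rw [← this]
      exact lintegral_congr fun ω => congrArg f (congrFun hV ω)
    have hmeas : ∀ f : (Fin (n + 2) → E) → ℝ≥0∞, Measurable f →
        Measurable fun x : Fin (n + 1) → E =>
          ∫⁻ y, f (J (x, y)) ∂(P s r (x (Fin.last n))) := fun f hf =>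
      (hf.comp hJ).lintegral_kernel_prod_right'
          (κ := (P s r).comap (fun x : Fin (n + 1) → E => x (Fin.last n)) (by fun_prop))
    intro f₁ f₂ f₃ f₄ h₁ h₂ h₃ h₄ hf
    rw [hint f₁ h₁, hint f₂ h₂, hint f₃ h₃, hint f₄ h₄]
    refine ih _ _ _ _ (hmeas _ h₁) (hmeas _ h₂) (hmeas _ h₃) (hmeas _ h₄) fun x x' => ?_
    have hsec : ∀ f : (Fin (n + 2) → E) → ℝ≥0∞, Measurable f → ∀ x,
        Measurable fun y => f (J (x, y)) :=
      fun f hf x => hf.comp (hJ.comp measurable_prodMk_left)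
    have hf' : ∀ y y', f₁ (J (x, y)) * f₂ (J (x', y')) ≤
        f₃ (J (x ⊓ x', y ⊓ y')) * f₄ (J (x ⊔ x', y ⊔ y')) := fun y y' => by
      rw [← hJinf, ← hJsup]; exact hf _ _
    -- Ordered starting points use the likelihood ratio order; equal ones use four functions for a
    -- single kernel measure; reversed ones reduce to the first case by exchanging `f₁` with `f₂`.
    rcases lt_trichotomy (x (Fin.last n)) (x' (Fin.last n)) with hx | hx | hx
    · have hl := hlr s r hsr _ _ hx
      simp only [Pi.inf_apply, Pi.sup_apply, inf_of_le_left hx.le, sup_of_le_right hx.le]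
      exact hl.lintegral_mul_le (hsec _ h₁ _) (hsec _ h₂ _) (hsec _ h₃ _) (hsec _ h₄ _) hf'
    · simp only [Pi.inf_apply, Pi.sup_apply, hx, inf_idem, sup_idem]
      exact fourFunctions_of_linearOrder _ _ _ _ _ (hsec _ h₁ _) (hsec _ h₂ _) (hsec _ h₃ _)
        (hsec _ h₄ _) hf'
    · have hl := hlr s r hsr _ _ hx
      simp only [Pi.inf_apply, Pi.sup_apply, inf_of_le_right hx.le, sup_of_le_left hx.le]
      rw [mul_comm]
      refine hl.lintegral_mul_le (hsec _ h₂ _) (hsec _ h₁ _) (hsec _ h₃ _) (hsec _ h₄ _) ?_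
      intro y y'
      rw [mul_comm, inf_comm y, sup_comm y]
      exact hf' y' y

/-- A Markov process whose transition kernels are monotone in the likelihood ratio order is
strongly conditionally monotone, in any real scale. -/
theorem HasTransition.isSCM [LinearOrder E] {X : ℝ≥0 → Ω → E}
    {P : ℝ≥0 → ℝ≥0 → Kernel E E} {μ : Measure Ω} [IsProbabilityMeasure μ]
    (hX : ∀ t, Measurable (X t))
    (hP : ∀ s t, s < t → IsMarkovKernel (P s t)) (h : HasTransition X P μ)
    (hlr : ∀ s t, s < t → ∀ x y, x < y → LikelihoodRatioLE (P s t x) (P s t y))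
    {g : E → ℝ} (hg : Measurable g) (hgm : Monotone g) {Z : ℝ≥0 → Ω → ℝ}
    (hZ : ∀ t, Measurable (Z t)) (hZX : ∀ t, Z t =ᵐ[μ] fun ω => g (X t ω)) : IsSCM Z μ := by
  rintro (_ | n) t ht
  · intro i; exact i.elim0
  refine FourFunctions.isSCMVector (fun k => hZ _) ?_
  -- The times may come in any order. Sorting them, then permuting back and applying `g`
  -- coordinatewise, is a lattice homomorphism.
  set σ := Tuple.sort t
  have hσ : StrictMono (t ∘ σ) :=
    (Tuple.monotone_sort t).strictMono_of_injective (ht.comp σ.injective)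
  have h4 := h.fourFunctions hX hP hlr (t ∘ σ) hσ
  set R : (Fin (n + 1) → E) → (Fin (n + 1) → ℝ) := fun x k => g (x (σ.symm k))
  have hR : Measurable R := by fun_prop
  have h5 := h4.map hR (fun x y => by ext k; simp [R, hgm.map_inf])
    (fun x y => by ext k; simp [R, hgm.map_sup])
  rw [Measure.map_map hR (measurable_pi_lambda _ fun k => hX _)] at h5
  convert h5 using 1
  refine Measure.map_congr ?_
  filter_upwards [ae_all_iff.2 fun k => hZX (t k)] with ω hω
  ext k
  simp [R, hω]

end Chain

/-! ### From TP₂ kernels to the likelihood ratio order. -/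

theorem IsMarkovProcess.hasTransition {Ω E : Type*} [MeasurableSpace Ω] [MeasurableSpace E]
    {X : ℝ≥0 → Ω → E} {P : ℝ≥0 → ℝ≥0 → Kernel E E} {μ : Measure Ω} [IsFiniteMeasure μ]
    (h : IsMarkovProcess X P μ) : HasTransition X P μ := by
  intro s t hst A hA B hB
  have := h.markovKernel s t hst
  have hm := past_le h.measurable s
  have hB' : MeasurableSet (X t ⁻¹' B) := h.measurable t hB
  have hint : Integrable ((X t ⁻¹' B).indicator fun _ => (1 : ℝ)) μ :=
    (integrable_const 1).indicator hB'
  have h1 := setIntegral_condExp hm hint hA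
  rw [setIntegral_congr_ae (hm _ hA) ((h.condProb_eq s t hst B hB).mono fun ω hω _ => hω),
    setIntegral_indicator hB'] at h1
  have hmeas : Measurable fun ω => P s t (X s ω) B :=
    (Kernel.measurable_coe _ hB).comp (h.measurable s)
  simp only [measureReal_def] at h1
  rw [integral_toReal hmeas.aemeasurable (by filter_upwards with ω using measure_lt_top _ _)] at h1
  simp only [integral_const, smul_eq_mul, mul_one, measureReal_restrict_apply_univ] at h1
  refine ((ENNReal.toReal_eq_toReal_iff' ?_ (measure_ne_top _ _)).1 h1).symm
  refine ne_top_of_le_ne_top (measure_ne_top μ A) ?_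
  calc ∫⁻ ω in A, P s t (X s ω) B ∂μ ≤ ∫⁻ ω in A, 1 ∂μ := lintegral_mono fun ω => prob_le_one
    _ = μ A := by simp

/-- Relative to `m₁ + m₂` both measures have densities that are limits of ratios over balls, so the
inequality for ordered sets passes to these densities at almost every point. -/
theorem exists_density_of_mul_le_mul (m₁ m₂ : Measure ℝ) [IsFiniteMeasure m₁] [IsFiniteMeasure m₂]
    (h : ∀ A B : Set ℝ, MeasurableSet A → MeasurableSet B → (∀ a ∈ A, ∀ b ∈ B, a < b) →
      m₁ B * m₂ A ≤ m₁ A * m₂ B) :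
    ∃ p₁ p₂ : ℝ → ℝ≥0∞, Measurable p₁ ∧ Measurable p₂ ∧ m₁ = (m₁ + m₂).withDensity p₁ ∧
      m₂ = (m₁ + m₂).withDensity p₂ ∧ ∀ x y, x < y → p₁ y * p₂ x ≤ p₁ x * p₂ y := by
  set ν := m₁ + m₂
  have hac₁ : m₁ ≪ ν := Measure.absolutelyContinuous_of_le (Measure.le_add_right le_rfl)
  have hac₂ : m₂ ≪ ν := Measure.absolutelyContinuous_of_le (Measure.le_add_left le_rfl)
  have hS := (Besicovitch.ae_tendsto_rnDeriv m₁ ν).and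
    ((Besicovitch.ae_tendsto_rnDeriv m₂ ν).and ((Measure.rnDeriv_lt_top m₁ ν).and
      (Measure.rnDeriv_lt_top m₂ ν)))
  obtain ⟨T, hT, hTm, hTS⟩ := hS.exists_measurable_mem
  have hden : ∀ m : Measure ℝ, IsFiniteMeasure m → m ≪ ν →
      m = ν.withDensity (T.indicator (m.rnDeriv ν)) := by
    intro m _ hm
    conv_lhs => rw [← Measure.withDensity_rnDeriv_eq m ν hm]
    refine withDensity_congr_ae ?_
    filter_upwards [hT] with x hx
    rw [indicator_of_mem hx]
  -- Setting the densities to `0` off the good set `T` makes the inequality hold for all pairs: its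
  -- left side vanishes if `x` or `y` lies outside `T`.
  refine ⟨T.indicator (m₁.rnDeriv ν), T.indicator (m₂.rnDeriv ν),
    (Measure.measurable_rnDeriv _ _).indicator hTm,
    (Measure.measurable_rnDeriv _ _).indicator hTm, hden m₁ inferInstance hac₁,
    hden m₂ inferInstance hac₂, fun x y hxy => ?_⟩
  by_cases hx : x ∈ T
  swap
  · simp [hx]
  by_cases hy : y ∈ T
  swap
  · simp [hy]
  simp only [indicator_of_mem hx, indicator_of_mem hy]
  obtain ⟨hx₁, hx₂, hx₁', hx₂'⟩ := hTS x hx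
  obtain ⟨hy₁, hy₂, hy₁', hy₂'⟩ := hTS y hy
  refine le_of_tendsto_of_tendsto
    (ENNReal.Tendsto.mul hy₁ (Or.inr hx₂'.ne) hx₂ (Or.inr hy₁'.ne))
    (ENNReal.Tendsto.mul hx₁ (Or.inr hy₂'.ne) hy₂ (Or.inr hx₁'.ne)) ?_
  have hpos : (0 : ℝ) < (y - x) / 3 := by linarith
  filter_upwards [Ioo_mem_nhdsGT hpos] with r hr
  have := h (Metric.closedBall x r) (Metric.closedBall y r) measurableSet_closedBall
    measurableSet_closedBall fun a ha b hb => by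
      rw [Real.closedBall_eq_Icc] at ha hb
      have := ha.2
      have := hb.1
      have := hr.2
      linarith
  simp only [div_eq_mul_inv]
  rw [mul_mul_mul_comm, mul_mul_mul_comm (m₁ (Metric.closedBall x r)),
    mul_comm (ν (Metric.closedBall y r))⁻¹]
  exact mul_le_mul_left this _

theorem likelihoodRatioLE_of_mul_le_mul {I : Set ℝ} (m₁ m₂ : Measure I) [IsFiniteMeasure m₁]
    [IsFiniteMeasure m₂]
    (h : ∀ A B : Set I, MeasurableSet A → MeasurableSet B → (∀ a ∈ A, ∀ b ∈ B, a < b) →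
      m₁ B * m₂ A ≤ m₁ A * m₂ B) : LikelihoodRatioLE m₁ m₂ := by
  have hv : Measurable (Subtype.val : I → ℝ) := measurable_subtype_coe
  obtain ⟨p₁, p₂, hp₁, hp₂, hm₁, hm₂, hp⟩ := exists_density_of_mul_le_mul
    (m₁.map Subtype.val) (m₂.map Subtype.val) (fun A B hA hB hAB => by
      rw [Measure.map_apply hv hA, Measure.map_apply hv hB, Measure.map_apply hv hA,
        Measure.map_apply hv hB]
      exact h _ _ (hv hA) (hv hB) fun a ha b hb => hAB _ ha _ hb)
  have hden : ∀ (m : Measure I) (p : ℝ → ℝ≥0∞), Measurable p →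
      m.map Subtype.val = (m₁.map Subtype.val + m₂.map Subtype.val).withDensity p →
      m = (m₁ + m₂).withDensity fun x => p x := by
    intro m p hpm hm
    refine Measure.ext fun B hB => ?_
    obtain ⟨C, hC, rfl⟩ := hB
    rw [← Measure.map_apply hv hC, hm, ← Measure.map_add _ _ hv, withDensity_apply _ hC,
      withDensity_apply _ (hv hC), setLIntegral_map hC hpm hv]
  exact ⟨m₁ + m₂, fun x => p₁ x, fun x => p₂ x, inferInstance, hp₁.comp hv, hp₂.comp hv,
    hden _ _ hp₁ hm₁, hden _ _ hp₂ hm₂, fun x y hxy => hp x y hxy⟩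

/-! ### Independent increments on an ordered group. -/

section IndepIncr

variable {Ω E : Type*} [MeasurableSpace Ω] [MeasurableSpace E] [AddCommGroup E]
  [MeasurableAdd₂ E] [MeasurableSub₂ E]

/-- The transition kernels of a process with independent increments. -/
noncomputable def incrKernel (X : ℝ≥0 → Ω → E) (μ : Measure Ω) (s t : ℝ≥0) : Kernel E E :=
  (Kernel.id ×ₖ Kernel.const E (μ.map fun ω => X t ω - X s ω)).map fun p => p.1 + p.2

omit [MeasurableSub₂ E] in
theorem incrKernel_apply (X : ℝ≥0 → Ω → E) (μ : Measure Ω) [IsFiniteMeasure μ] (s t : ℝ≥0)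
    (x : E) : incrKernel X μ s t x = (μ.map fun ω => X t ω - X s ω).map fun y => x + y := by
  rw [incrKernel, Kernel.map_apply _ measurable_add, Kernel.prod_apply, Kernel.id_apply,
    Kernel.const_apply, Measure.dirac_prod, Measure.map_map measurable_add (by fun_prop)]
  rfl

theorem isMarkovKernel_incrKernel {X : ℝ≥0 → Ω → E} {μ : Measure Ω} [IsProbabilityMeasure μ]
    (hX : ∀ t, Measurable (X t)) (s t : ℝ≥0) : IsMarkovKernel (incrKernel X μ s t) := by
  have : IsProbabilityMeasure (μ.map fun ω => X t ω - X s ω) :=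
    Measure.isProbabilityMeasure_map ((hX t).sub (hX s)).aemeasurable
  exact Kernel.IsMarkovKernel.map _ measurable_add

theorem hasTransition_incrKernel {X : ℝ≥0 → Ω → E} {μ : Measure Ω} [IsProbabilityMeasure μ]
    (hX : ∀ t, Measurable (X t))
    (h : ∀ s t, s < t → ∀ A, MeasurableSet[past X s] A → ∀ B, MeasurableSet B →
      μ (A ∩ (fun ω => X t ω - X s ω) ⁻¹' B) = μ A * μ ((fun ω => X t ω - X s ω) ⁻¹' B)) :
    HasTransition X (incrKernel X μ) μ := by
  intro s t hst A hA B hB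
  set D : Ω → E := fun ω => X t ω - X s ω
  have hD : Measurable D := (hX t).sub (hX s)
  have hA' : MeasurableSet A := past_le hX s _ hA
  -- Independence of the increment from the whole past keeps `X s` and `D` independent after
  -- restriction to a past event `A`.
  have hprod : ((μ.restrict A).map (X s)).prod (μ.map D) =
      (μ.restrict A).map fun ω => (X s ω, D ω) := by
    refine Measure.prod_eq fun U V hU hV => ?_
    rw [Measure.map_apply ((hX s).prodMk hD) (hU.prod hV), Measure.map_apply (hX s) hU,
      Measure.map_apply hD hV, Measure.restrict_apply (((hX s).prodMk hD) (hU.prod hV)),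
      Measure.restrict_apply ((hX s) hU),
      ← h s t hst _ (((measurable_past X le_rfl) hU).inter hA) V hV]
    congr 1
    ext ω
    simp only [mem_inter_iff, mem_preimage, mem_prod]
    tauto
  have hS : MeasurableSet {p : E × E | p.1 + p.2 ∈ B} := measurable_add hB
  have h1 : μ (A ∩ X t ⁻¹' B) = (μ.restrict A).map (fun ω => (X s ω, D ω)) {p | p.1 + p.2 ∈ B} := by
    rw [Measure.map_apply ((hX s).prodMk hD) hS,
      Measure.restrict_apply (((hX s).prodMk hD) hS), inter_comm]
    congr 2
    ext ω
    simp [D]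
  rw [h1, ← hprod, Measure.prod_apply hS, lintegral_map (measurable_measure_prodMk_left hS) (hX s)]
  refine lintegral_congr fun ω => ?_
  rw [incrKernel_apply, Measure.map_apply (measurable_const_add _) hB]
  rfl

omit [MeasurableSub₂ E] in
theorem map_add_left_withDensity (m : Measure E) [m.IsAddLeftInvariant] (p : E → ℝ≥0∞) (x : E) :
    (m.withDensity p).map (fun y => x + y) = m.withDensity fun y => p (y - x) := by
  refine Measure.ext fun B hB => ?_
  have hx : Measurable fun y => x + y := measurable_const_add x
  rw [Measure.map_apply hx hB, withDensity_apply _ (hx hB), withDensity_apply _ hB,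
    ← lintegral_indicator (hx hB), ← lintegral_indicator hB, ← lintegral_add_left_eq_self (B.indicator fun y => p (y - x)) x]
  refine lintegral_congr fun y => ?_
  by_cases hy : x + y ∈ B <;> simp [indicator, hy]

/-- For `u < v` the pair `u - y`, `v - x` has the same sum as `u - x`, `v - y` but is spread further
apart, which is the four-point form of log-concavity. -/
theorem likelihoodRatioLE_map_add [LinearOrder E] [IsOrderedAddMonoid E] (m : Measure E) [SFinite m]
    [m.IsAddLeftInvariant] {p : E → ℝ≥0∞} (hp : Measurable p)
    (h : ∀ a b c d, a < c → a < d → a + b = c + d → p a * p b ≤ p c * p d) {x y : E}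
    (hxy : x < y) :
    LikelihoodRatioLE ((m.withDensity p).map fun z => x + z)
      ((m.withDensity p).map fun z => y + z) := by
  refine ⟨m, _, _, inferInstance, ?_, ?_, map_add_left_withDensity m p x,
    map_add_left_withDensity m p y, fun u v huv => ?_⟩
  · exact hp.comp (measurable_id.sub_const x)
  · exact hp.comp (measurable_id.sub_const y)
  · rw [mul_comm]
    refine h _ _ _ _ (sub_lt_sub_left hxy u) (sub_lt_sub_right huv y) ?_
    abel

end IndepIncr

/-! ### Four-point form of log-concavity, on the line and on the integers. -/

theorem mul_le_mul_of_logConcave {p : ℝ → ℝ≥0}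
    (h : ∀ x y θ : ℝ, 0 < θ → θ < 1 → p x ^ θ * p y ^ (1 - θ) ≤ p (θ * x + (1 - θ) * y))
    {a b c d : ℝ} (hac : a < c) (had : a < d) (hs : a + b = c + d) : p a * p b ≤ p c * p d := by
  have hab : 0 < b - a := by linarith
  -- The weight for which `c = θ a + (1 - θ) b`; equality of the sums gives `d` the exchanged
  -- weights, and the two log-concavity inequalities multiply to the claim.
  set θ := (b - c) / (b - a)
  have h0 : 0 < θ := div_pos (by linarith) hab
  have h1 : θ < 1 := (div_lt_one hab).2 (by linarith)
  have hc : θ * a + (1 - θ) * b = c := by simp only [θ]; field_simp; ring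
  have hd : (1 - θ) * a + (1 - (1 - θ)) * b = d := by
    have : d = a + b - c := by linarith
    rw [this, ← hc]; ring
  have e1 := h a b θ h0 h1
  have e2 := h a b (1 - θ) (by linarith) (by linarith)
  rw [hc] at e1
  rw [hd] at e2
  have hpow : ∀ u : ℝ≥0, u ^ θ * u ^ (1 - θ) = u := fun u => by
    rw [← NNReal.rpow_add' (by simp), add_sub_cancel, NNReal.rpow_one]
  calc p a * p b = (p a ^ θ * p a ^ (1 - θ)) * (p b ^ θ * p b ^ (1 - θ)) := by rw [hpow, hpow]
    _ = (p a ^ θ * p b ^ (1 - θ)) * (p a ^ (1 - θ) * p b ^ (1 - (1 - θ))) := by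
      rw [sub_sub_cancel]; ring
    _ ≤ p c * p d := mul_le_mul' e1 e2

theorem IsLogConcaveSeq.mul_le_succ_mul_pred {p : ℤ → ℝ} (hp : IsLogConcaveSeq p)
    (h0 : ∀ k, 0 ≤ p k) (a : ℤ) : ∀ n : ℕ, p a * p (a + n + 1) ≤ p (a + 1) * p (a + n)
  | 0 => by simp [mul_comm]
  | n + 1 => by
    have ih := hp.mul_le_succ_mul_pred h0 a n
    have hb := hp.1 (a + n + 1)
    push_cast
    rw [show a + n + 1 - 1 = a + n by ring] at hb
    rw [show a + ((n : ℤ) + 1) = a + n + 1 by ring]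
    rcases (h0 a).eq_or_lt with ha | ha
    · rw [← ha, zero_mul]; exact mul_nonneg (h0 _) (h0 _)
    rcases (h0 (a + n + 1 + 1)).eq_or_lt with hc | hc
    · rw [← hc, mul_zero]; exact mul_nonneg (h0 _) (h0 _)
    -- The absence of gaps makes the interior terms positive, so they can be cancelled after
    -- multiplying the induction hypothesis by log-concavity at `a + n + 1`.
    have hpos1 : 0 < p (a + n + 1) :=
      lt_of_le_of_ne (h0 _) (hp.2 a _ (a + n + 1 + 1) (by omega) (by omega) ha.ne' hc.ne').symm
    have hpos2 : 0 < p (a + n) := by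
      rcases n.eq_zero_or_pos with rfl | hn
      · simpa using ha
      · exact lt_of_le_of_ne (h0 _)
          (hp.2 a _ (a + n + 1 + 1) (by omega) (by omega) ha.ne' hc.ne').symm
    refine le_of_mul_le_mul_right ?_ (mul_pos hpos1 hpos2)
    calc p a * p (a + n + 1 + 1) * (p (a + n + 1) * p (a + n))
        = (p a * p (a + n + 1)) * (p (a + n) * p (a + n + 1 + 1)) := by ring
      _ ≤ (p (a + 1) * p (a + n)) * p (a + n + 1) ^ 2 :=
        mul_le_mul ih hb (mul_nonneg (h0 _) (h0 _)) (mul_nonneg (h0 _) (h0 _))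
      _ = _ := by ring

theorem IsLogConcaveSeq.mul_le_mul {p : ℤ → ℝ} (hp : IsLogConcaveSeq p)
    (h0 : ∀ k, 0 ≤ p k) {a b c d : ℤ} (hac : a < c) (had : a < d) (hs : a + b = c + d) :
    p a * p b ≤ p c * p d := by
  -- Both ends move inwards one unit at a time; `a + 2 * j ≤ b` keeps them from crossing.
  have key : ∀ j : ℕ, ∀ a b : ℤ, a + 2 * j ≤ b → p a * p b ≤ p (a + j) * p (b - j) := by
    intro j
    induction j with
    | zero => intro a b _; simp
    | succ j ih =>
      intro a b hab
      push_cast at hab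
      obtain ⟨n, hn⟩ := Int.eq_ofNat_of_zero_le (show 0 ≤ b - a - 1 by omega)
      have e1 := hp.mul_le_succ_mul_pred h0 a n
      rw [show a + (n : ℤ) + 1 = b by omega, show a + (n : ℤ) = b - 1 by omega] at e1
      refine e1.trans ((ih (a + 1) (b - 1) (by omega)).trans_eq ?_)
      push_cast
      congr 2 <;> ring
  rcases le_total c d with hcd | hcd
  · obtain ⟨j, hj⟩ := Int.eq_ofNat_of_zero_le (show 0 ≤ c - a by omega)
    have := key j a b (by omega)
    rwa [show a + (j : ℤ) = c by omega, show b - (j : ℤ) = d by omega] at this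
  · obtain ⟨j, hj⟩ := Int.eq_ofNat_of_zero_le (show 0 ≤ d - a by omega)
    have := key j a b (by omega)
    rwa [show a + (j : ℤ) = d by omega, show b - (j : ℤ) = c by omega, mul_comm (p d)] at this

/-! ### The MTP₂, Markov and independent increment cases. -/

section Processes

variable {Ω : Type*} [MeasurableSpace Ω] (μ : Measure Ω) [IsProbabilityMeasure μ]

theorem HasMTP2Marginals.isSCM (X : ℝ≥0 → Ω → ℝ) (hX : ∀ t, Measurable (X t))
    (h : HasMTP2Marginals X μ) : IsSCM X μ := by
  rintro (_ | _ | n) t ht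
  · intro i; exact i.elim0
  -- The MTP₂ assumption starts at `n = 2`; a single coordinate is covered by the inequality on a
  -- chain.
  · refine FourFunctions.isSCMVector (fun k => hX _) ?_
    have hc : Measurable fun (x : ℝ) (_ : Fin 1) => x := by fun_prop
    have := (fourFunctions_of_linearOrder (μ.map (X (t 0)))).map hc (fun _ _ => rfl)
      (fun _ _ => rfl)
    rw [Measure.map_map hc (hX _)] at this
    convert this using 2
    ext ω k
    rw [show k = 0 from Fin.fin_one_eq_zero k]
    rfl
  · exact (h _ (by omega) t ht).fourFunctions.isSCMVector fun k => hX _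

theorem IsMarkovProcess.isSCM {I : Set ℝ} (X : ℝ≥0 → Ω → I)
    (P : ℝ≥0 → ℝ≥0 → Kernel I I) (hX : IsMarkovProcess X P μ)
    (hP : ∀ s t, s < t → IsTP2Kernel (P s t)) : IsSCM (fun t ω => (X t ω : ℝ)) μ := by
  refine hX.hasTransition.isSCM hX.measurable hX.markovKernel (fun s t hst x y hxy => ?_)
    measurable_subtype_coe (Subtype.mono_coe I) (fun t => (hX.measurable t).subtype_val)
    fun t => Filter.EventuallyEq.rfl
  have := hX.markovKernel s t hst
  exact likelihoodRatioLE_of_mul_le_mul _ _ fun A B hA hB hAB => hP s t hst x y hxy A B hA hB hAB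

theorem HasIndepIncr.isSCM_of_hasLogConcaveDensity (X : ℝ≥0 → Ω → ℝ) (hX : ∀ t, Measurable (X t))
    (hi : HasIndepIncr X μ)
    (h : ∀ s t, s < t → HasLogConcaveDensity (μ.map (fun ω => X t ω - X s ω))) : IsSCM X μ := by
  have ht : HasTransition X (incrKernel X μ) μ := hasTransition_incrKernel hX
    fun s t hst A hA B hB => by
      rw [inter_comm, mul_comm]
      exact (Indep_iff _ _ _).1 (hi s t hst.le) _ A ⟨B, hB, rfl⟩ hA
  refine ht.isSCM hX (fun s t _ => isMarkovKernel_incrKernel hX s t) (fun s t hst x y hxy => ?_)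
    measurable_id monotone_id hX fun t => Filter.EventuallyEq.rfl
  obtain ⟨p, hp, hlc, heq⟩ := h s t hst
  rw [incrKernel_apply, incrKernel_apply, heq]
  refine likelihoodRatioLE_map_add volume (by fun_prop) (fun a b c d hac had hs => ?_) hxy
  exact_mod_cast mul_le_mul_of_logConcave hlc hac had hs

theorem HasIndepIncr.isSCM_of_isLogConcaveSeq (X : ℝ≥0 → Ω → ℝ) (hX : ∀ t, Measurable (X t))
    (hZ : ∀ t, ∀ᵐ ω ∂μ, ∃ k : ℤ, X t ω = k) (hi : HasIndepIncr X μ)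
    (h : ∀ s t, s < t → IsLogConcaveSeq (fun k : ℤ => μ.real {ω | X t ω - X s ω = (k : ℝ)})) :
    IsSCM X μ := by
  -- A version with values in `ℤ` everywhere. The floor of `X u` is a function of `X u`, so `Z` has
  -- a smaller past and independence is inherited.
  set Z : ℝ≥0 → Ω → ℤ := fun t ω => ⌊X t ω⌋
  have hZm : ∀ t, Measurable (Z t) := fun t => (hX t).floor
  have hZX : ∀ t, X t =ᵐ[μ] fun ω => ((Z t ω : ℤ) : ℝ) := by
    intro t
    filter_upwards [hZ t] with ω hω
    obtain ⟨k, hk⟩ := hω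
    simp [Z, hk]
  have hD : ∀ s t (B : Set ℤ), (fun ω => Z t ω - Z s ω) ⁻¹' B =ᵐ[μ]
      (fun ω => X t ω - X s ω) ⁻¹' ((fun k : ℤ => (k : ℝ)) '' B) := by
    intro s t B
    refine Filter.eventuallyEq_set.2 ?_
    filter_upwards [hZX s, hZX t] with ω h1 h2
    simp only [mem_preimage, h1, h2, ← Int.cast_sub]
    exact (Int.cast_injective.mem_set_image).symm
  have hpast : ∀ s, past Z s ≤ past X s := fun s => iSup₂_mono fun u _ => by
    have : Z u = (fun x : ℝ => ⌊x⌋) ∘ X u := rfl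
    rw [this, ← MeasurableSpace.comap_comp]
    exact MeasurableSpace.comap_mono Int.measurable_floor.comap_le
  have hB : ∀ B : Set ℤ, MeasurableSet ((fun k : ℤ => (k : ℝ)) '' B) := fun B =>
    (B.to_countable.image _).measurableSet
  have ht : HasTransition Z (incrKernel Z μ) μ := hasTransition_incrKernel hZm
    fun s t hst A hA B _ => by
      rw [measure_congr (hD s t B), measure_congr (Filter.EventuallyEq.rfl.inter (hD s t B)),
        inter_comm, mul_comm]
      exact (Indep_iff _ _ _).1 (hi s t hst.le) _ A ⟨_, hB B, rfl⟩ (hpast s _ hA)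
  refine ht.isSCM hZm (fun s t _ => isMarkovKernel_incrKernel hZm s t)
    (fun s t hst x y hxy => ?_) (measurable_of_countable fun k : ℤ => (k : ℝ)) Int.cast_mono hX hZX
  set p : ℤ → ℝ := fun k : ℤ => μ.real {ω | X t ω - X s ω = (k : ℝ)}
  have hp0 : ∀ k, 0 ≤ p k := fun k => measureReal_nonneg
  have hlaw : (μ.map fun ω => Z t ω - Z s ω) =
      Measure.count.withDensity fun k => ENNReal.ofReal (p k) := by
    refine Measure.ext_of_singleton fun k => ?_
    have hDm : Measurable fun ω => Z t ω - Z s ω := (hZm t).sub (hZm s)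
    rw [Measure.map_apply hDm (measurableSet_singleton k),
      withDensity_apply _ (measurableSet_singleton k), measure_congr (hD s t {k})]
    simp [p, Measure.restrict_singleton, measureReal_def, preimage]
  rw [incrKernel_apply, incrKernel_apply, hlaw]
  refine likelihoodRatioLE_map_add Measure.count (measurable_of_countable _)
    (fun a b c d hac had hs => ?_) hxy
  rw [← ENNReal.ofReal_mul (hp0 _), ← ENNReal.ofReal_mul (hp0 _)]
  exact ENNReal.ofReal_le_ofReal ((h s t hst).mul_le_mul hp0 hac had hs)

end Processes

/-! ### Hitting times of continuous paths. -/

section Hitting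

variable {Ω : Type*}

/-- The first time before `t` at which the path `d` is non-negative, and `t` if there is none. -/
noncomputable def hitTime (d : ℝ≥0 → ℝ) (t : ℝ≥0) : ℝ≥0 := sInf {u | 0 ≤ d u ∨ t ≤ u}

theorem hitTime_mem {d : ℝ≥0 → ℝ} (hd : Continuous d) (t : ℝ≥0) :
    0 ≤ d (hitTime d t) ∨ t ≤ hitTime d t :=
  IsClosed.csInf_mem ((isClosed_le continuous_const hd).union isClosed_Ici) ⟨t, Or.inr (le_refl t)⟩
    (OrderBot.bddBelow _)

theorem hitTime_le_of_nonneg {d : ℝ≥0 → ℝ} {t u : ℝ≥0} (h : 0 ≤ d u) : hitTime d t ≤ u :=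
  csInf_le (OrderBot.bddBelow _) (Or.inl h)

theorem hitTime_le (d : ℝ≥0 → ℝ) (t : ℝ≥0) : hitTime d t ≤ t :=
  csInf_le (OrderBot.bddBelow _) (Or.inr le_rfl)

theorem hitTime_le_iff {d : ℝ≥0 → ℝ} (hd : Continuous d) {t s : ℝ≥0} :
    hitTime d t ≤ s ↔ t ≤ s ∨ ∃ u ≤ s, 0 ≤ d u := by
  constructor
  · intro h
    rcases hitTime_mem hd t with h' | h'
    · exact Or.inr ⟨_, h, h'⟩
    · exact Or.inl (h'.trans h)
  · rintro (h | ⟨u, hu, h⟩)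
    · exact (hitTime_le d t).trans h
    · exact (hitTime_le_of_nonneg h).trans hu

theorem eq_zero_of_hitTime_lt {d : ℝ≥0 → ℝ} (hd : Continuous d) (h0 : d 0 < 0) {t : ℝ≥0}
    (h : hitTime d t < t) : d (hitTime d t) = 0 := by
  have h1 : 0 ≤ d (hitTime d t) := (hitTime_mem hd t).resolve_right (not_le.2 h)
  obtain ⟨u, hu, hu0⟩ := intermediate_value_Icc (zero_le (a := hitTime d t)) hd.continuousOn
    ⟨h0.le, h1⟩
  rw [le_antisymm (hitTime_le_of_nonneg hu0.ge) hu.2, hu0]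

theorem hitTime_lt {d : ℝ≥0 → ℝ} (hd : Continuous d) (h0 : d 0 < 0) {t : ℝ≥0}
    (h : 0 < d t) : hitTime d t < t := by
  obtain ⟨u, hu, hu0⟩ := intermediate_value_Icc (zero_le (a := t)) hd.continuousOn ⟨h0.le, h.le⟩
  refine (hitTime_le_of_nonneg hu0.ge).trans_lt (hu.2.lt_of_ne ?_)
  rintro rfl
  exact h.ne' hu0

theorem measurableSet_hitTime_le {m : MeasurableSpace Ω} {d : ℝ≥0 → Ω → ℝ}
    (hd : ∀ ω, Continuous fun u => d u ω) {t s : ℝ≥0} (hm : ∀ u ≤ s, Measurable (d u)) :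
    MeasurableSet {ω | hitTime (fun u => d u ω) t ≤ s} := by
  -- By continuity and compactness of `[0, s]`, reaching `0` means exceeding every `-1/(n+1)` along
  -- a countable dense set of times. Truncation by `min · s` uses the path only up to time `s`, as
  -- the stopping time property requires.
  have key : {ω | ∃ u ≤ s, 0 ≤ d u ω} = ⋂ n : ℕ, ⋃ k : ℕ,
      {ω | -(1 / ((n : ℝ) + 1)) < d (min (TopologicalSpace.denseSeq ℝ≥0 k) s) ω} := by
    ext ω
    simp only [mem_ofPred_eq, mem_iInter, mem_iUnion]
    constructor
    · rintro ⟨u, hu, h⟩ n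
      have ho : IsOpen {v : ℝ≥0 | -(1 / ((n : ℝ) + 1)) < d (min v s) ω} :=
        isOpen_lt continuous_const ((hd ω).comp (by fun_prop))
      have hn : (0 : ℝ) < 1 / ((n : ℝ) + 1) := by positivity
      obtain ⟨v, hv, k, rfl⟩ := (TopologicalSpace.denseRange_denseSeq ℝ≥0).inter_open_nonempty _ ho
        ⟨u, by rw [mem_ofPred_eq, min_eq_left hu]; linarith⟩
      exact ⟨k, hv⟩
    · intro h
      obtain ⟨u, hu, hmax⟩ := (isCompact_Icc (a := (0 : ℝ≥0)) (b := s)).exists_isMaxOn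
        ⟨0, le_rfl, zero_le⟩ (hd ω).continuousOn
      refine ⟨u, hu.2, le_of_forall_pos_lt_add fun ε hε => ?_⟩
      obtain ⟨n, hn⟩ := exists_nat_one_div_lt hε
      obtain ⟨k, hk⟩ := h n
      have : d (min (TopologicalSpace.denseSeq ℝ≥0 k) s) ω ≤ d u ω :=
        hmax (show min (TopologicalSpace.denseSeq ℝ≥0 k) s ∈ Icc 0 s from
          ⟨zero_le, min_le_right _ _⟩)
      linarith
  have : {ω | hitTime (fun u => d u ω) t ≤ s} = {ω | t ≤ s} ∪ {ω | ∃ u ≤ s, 0 ≤ d u ω} := by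
    ext ω
    exact hitTime_le_iff (hd ω)
  rw [this, key]
  refine (MeasurableSet.const _).union (MeasurableSet.iInter fun n => MeasurableSet.iUnion fun k => ?_)
  exact measurableSet_lt measurable_const (hm _ (min_le_right _ _))

theorem measurable_hitTime {m : MeasurableSpace Ω} {d : ℝ≥0 → Ω → ℝ}
    (hd : ∀ ω, Continuous fun u => d u ω) (hm : ∀ u, Measurable (d u)) (t : ℝ≥0) :
    Measurable fun ω => hitTime (fun u => d u ω) t :=
  measurable_of_Iic fun _ => measurableSet_hitTime_le hd fun u _ => hm u

end Hitting

/-! ### The strong Markov property at a fixed time after a stopping time. -/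

namespace IsDiffusion

variable {Ω : Type*} [MeasurableSpace Ω] {I : Set ℝ} {X : ℝ≥0 → Ω → I} {Q : Kernel I Ω}

theorem measurable_uncurry (h : IsDiffusion X Q) : Measurable (Function.uncurry X) :=
  measurable_uncurry_of_continuous_of_measurable h.continuous_path h.measurable

/-- The transition function as a kernel in time and space. -/
noncomputable def timeKernel (X : ℝ≥0 → Ω → I) (Q : Kernel I Ω) : Kernel (ℝ≥0 × I) I :=
  (Kernel.deterministic Prod.fst measurable_fst ×ₖ Q.comap Prod.snd measurable_snd).map
    (Function.uncurry X)

theorem timeKernel_apply (h : IsDiffusion X Q) (s : ℝ≥0) (x : I) :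
    timeKernel X Q (s, x) = (Q x).map (X s) := by
  have := h.markovKernel
  rw [timeKernel, Kernel.map_apply _ h.measurable_uncurry, Kernel.prod_apply,
    Kernel.deterministic_apply, Kernel.comap_apply, Measure.dirac_prod,
    Measure.map_map h.measurable_uncurry (by fun_prop)]
  rfl

theorem isMarkovKernel_timeKernel (h : IsDiffusion X Q) : IsMarkovKernel (timeKernel X Q) := by
  have := h.markovKernel
  exact Kernel.IsMarkovKernel.map _ h.measurable_uncurry

/-- The natural filtration of a diffusion. -/
noncomputable def filtration (h : IsDiffusion X Q) : Filtration ℝ≥0 (inferInstance : MeasurableSpace Ω) :=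
  Filtration.natural X fun t => (h.measurable t).stronglyMeasurable

section StrongMarkov

variable {τ : Ω → ℝ≥0}

theorem measurable_of_isStoppingTime (h : IsDiffusion X Q)
    (hτ : IsStoppingTime h.filtration fun ω => (τ ω : WithTop ℝ≥0)) :
    Measurable[hτ.measurableSpace] τ := by
  let _ := hτ.measurableSpace
  refine measurable_of_Iic fun i => ?_
  convert hτ.measurableSet_le' i using 1
  ext ω
  exact (WithTop.coe_le_coe (a := i) (b := τ ω)).symm

theorem measurable_stopped (h : IsDiffusion X Q) (hτ : Measurable τ) :
    Measurable fun ω => X (τ ω) ω :=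
  h.measurable_uncurry.comp (hτ.prodMk measurable_id)

theorem setLIntegral_add_const (h : IsDiffusion X Q)
    (hτ : IsStoppingTime h.filtration fun ω => (τ ω : WithTop ℝ≥0)) {A : Set Ω}
    (hA : MeasurableSet[hτ.measurableSpace] A) (x : I) (c : ℝ≥0) {g : I → ℝ≥0∞}
    (hg : Measurable g) :
    ∫⁻ ω in A, g (X (τ ω + c) ω) ∂(Q x) =
      ∫⁻ ω in A, ∫⁻ z, g z ∂(timeKernel X Q (c, X (τ ω) ω)) ∂(Q x) := by
  have hτm : Measurable τ := (h.measurable_of_isStoppingTime hτ).mono hτ.measurableSpace_le le_rfl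
  have h1 : Measurable fun ω => X (τ ω + c) ω := h.measurable_stopped (hτm.add_const c)
  have h2 : Measurable fun ω => (c, X (τ ω) ω) :=
    measurable_const.prodMk (h.measurable_stopped hτm)
  have key : ((Q x).restrict A).map (fun ω => X (τ ω + c) ω) =
      (((Q x).restrict A).map fun ω => (c, X (τ ω) ω)).bind (timeKernel X Q) := by
    refine Measure.ext fun B hB => ?_
    rw [Measure.map_apply h1 hB, Measure.restrict_apply (h1 hB), inter_comm,
      Measure.bind_apply hB (Kernel.aemeasurable _),
      lintegral_map ((timeKernel X Q).measurable_coe hB) h2]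
    refine (h.strongMarkov τ hτ A hA x c B hB).trans (lintegral_congr fun ω => ?_)
    rw [h.timeKernel_apply, Measure.map_apply (h.measurable c) hB]
  rw [← lintegral_map hg h1, key, Measure.lintegral_bind (Kernel.aemeasurable _) hg.aemeasurable,
    lintegral_map hg.lintegral_kernel h2]

/-- The delay may depend on the past of `τ` when it takes countably many values: split `A` according
to `N`, on each piece of which the delay is constant. -/
theorem setLIntegral_add_countable (h : IsDiffusion X Q)
    (hτ : IsStoppingTime h.filtration fun ω => (τ ω : WithTop ℝ≥0)) {A : Set Ω}
    (hA : MeasurableSet[hτ.measurableSpace] A) (x : I) {N : Ω → ℕ}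
    (hN : Measurable[hτ.measurableSpace] N) (c : ℕ → ℝ≥0) {g : I → ℝ≥0∞} (hg : Measurable g) :
    ∫⁻ ω in A, g (X (τ ω + c (N ω)) ω) ∂(Q x) =
      ∫⁻ ω in A, ∫⁻ z, g z ∂(timeKernel X Q (c (N ω), X (τ ω) ω)) ∂(Q x) := by
  have hAk : ∀ k, MeasurableSet[hτ.measurableSpace] (A ∩ N ⁻¹' {k}) := fun k =>
    MeasurableSet.inter hA (hN (measurableSet_singleton k))
  have hAk' : ∀ k, MeasurableSet (A ∩ N ⁻¹' {k}) := fun k => hτ.measurableSpace_le _ (hAk k)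
  have hdisj : Pairwise (Function.onFun Disjoint fun k => A ∩ N ⁻¹' {k}) := by
    intro i j hij
    refine Set.disjoint_left.2 fun ω h1 h2 => hij ?_
    rw [← show N ω = i from h1.2, ← show N ω = j from h2.2]
  have hU : A = ⋃ k, A ∩ N ⁻¹' {k} := by
    ext ω; simp
  rw [hU, lintegral_iUnion hAk' hdisj, lintegral_iUnion hAk' hdisj]
  congr 1
  ext k
  have e := h.setLIntegral_add_const hτ (hAk k) x (c k) hg
  rw [setLIntegral_congr_fun (hAk' k) (g := fun ω => g (X (τ ω + c k) ω)), e]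
  · refine setLIntegral_congr_fun (hAk' k) fun ω hω => ?_
    simp only [show N ω = k from hω.2]
  · intro ω hω
    simp only [show N ω = k from hω.2]

theorem tendsto_ceil_div (σ : ℝ≥0) :
    Filter.Tendsto (fun n : ℕ => ((⌈((n : ℝ≥0) + 1) * σ⌉₊ : ℕ) : ℝ≥0) / ((n : ℝ≥0) + 1))
      Filter.atTop (nhds σ) := by
  have h1 : Filter.Tendsto (fun n : ℕ => σ + 1 / ((n : ℝ≥0) + 1)) Filter.atTop (nhds σ) := by
    simpa using tendsto_const_nhds.add (tendsto_one_div_add_atTop_nhds_zero_nat (𝕜 := ℝ≥0))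
  refine tendsto_of_tendsto_of_tendsto_of_le_of_le tendsto_const_nhds h1 (fun n => ?_) fun n => ?_
  · have hn : (0 : ℝ≥0) < (n : ℝ≥0) + 1 := by positivity
    simp only
    rw [le_div_iff₀ hn, mul_comm]
    exact Nat.le_ceil _
  · have hn : (0 : ℝ≥0) < (n : ℝ≥0) + 1 := by positivity
    simp only
    rw [div_le_iff₀ hn, add_mul σ, one_div, inv_mul_cancel₀ hn.ne', mul_comm σ]
    exact (Nat.ceil_lt_add_one zero_le).le

/-- The random delay `t - τ` is approximated from above by `⌈(n+1)(t-τ)⌉/(n+1)`, which takes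
countably many values and is known at `τ`. Path continuity and dominated convergence pass to the
limit on both sides, for bounded continuous `g`. -/
theorem setLIntegral_eq_of_continuous (h : IsDiffusion X Q)
    (hτ : IsStoppingTime h.filtration fun ω => (τ ω : WithTop ℝ≥0)) {A : Set Ω}
    (hA : MeasurableSet[hτ.measurableSpace] A) (x : I) {t : ℝ≥0} (ht : ∀ ω, τ ω ≤ t)
    (g : I →ᵇ ℝ≥0) :
    ∫⁻ ω in A, g (X t ω) ∂(Q x) =
      ∫⁻ ω in A, ∫⁻ z, g z ∂(timeKernel X Q (t - τ ω, X (τ ω) ω)) ∂(Q x) := by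
  have := h.markovKernel
  have := h.isMarkovKernel_timeKernel
  have hτF := h.measurable_of_isStoppingTime hτ
  have hτm : Measurable τ := hτF.mono hτ.measurableSpace_le le_rfl
  have hg : Measurable fun z => (g z : ℝ≥0∞) := by
    have := g.continuous.measurable
    fun_prop
  have hgb : ∀ z, (g z : ℝ≥0∞) ≤ nndist g 0 := fun z => by
    exact_mod_cast BoundedContinuousFunction.NNReal.upper_bound g z
  set N : ℕ → Ω → ℕ := fun n ω => ⌈((n : ℝ≥0) + 1) * (t - τ ω)⌉₊
  have hφ : ∀ n : ℕ, Measurable fun s : ℝ≥0 => ⌈((n : ℝ≥0) + 1) * (t - s)⌉₊ := fun n =>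
    Nat.measurable_ceil.comp (by fun_prop)
  have hNF : ∀ n, Measurable[hτ.measurableSpace] (N n) := fun n => (hφ n).comp hτF
  have hNm : ∀ n, Measurable (N n) := fun n => (hφ n).comp hτm
  set c : ℕ → ℕ → ℝ≥0 := fun n k => (k : ℝ≥0) / ((n : ℝ≥0) + 1)
  have hcm : ∀ n, Measurable fun ω => c n (N n ω) := fun n =>
    (measurable_of_countable (c n)).comp (hNm n)
  have hlim : ∀ ω, Filter.Tendsto (fun n => c n (N n ω)) Filter.atTop (nhds (t - τ ω)) :=
    fun ω => tendsto_ceil_div _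
  have e : ∀ n, ∫⁻ ω in A, g (X (τ ω + c n (N n ω)) ω) ∂(Q x) =
      ∫⁻ ω in A, ∫⁻ z, g z ∂(timeKernel X Q (c n (N n ω), X (τ ω) ω)) ∂(Q x) := fun n =>
    h.setLIntegral_add_countable hτ hA x (hNF n) (c n) hg
  have hfin : ∫⁻ _ in A, (nndist g 0 : ℝ≥0∞) ∂(Q x) ≠ ⊤ := by
    rw [lintegral_const]
    exact (ENNReal.mul_lt_top ENNReal.coe_lt_top (measure_lt_top _ _)).ne
  have hker : ∀ (s : ℝ≥0) (y : I), ∫⁻ z, g z ∂(timeKernel X Q (s, y)) =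
      ∫⁻ ω, g (X s ω) ∂(Q y) := fun s y => by
    rw [h.timeKernel_apply, lintegral_map hg (h.measurable s)]
  have hker_le : ∀ p, ∫⁻ z, g z ∂(timeKernel X Q p) ≤ nndist g 0 := fun p =>
    (lintegral_mono hgb).trans_eq (by simp)
  have hconv : ∀ ω (s : ℕ → ℝ≥0) (r : ℝ≥0), Filter.Tendsto s Filter.atTop (nhds r) →
      Filter.Tendsto (fun n => (g (X (s n) ω) : ℝ≥0∞)) Filter.atTop (nhds (g (X r ω))) :=
    fun ω s r hs => ENNReal.tendsto_coe.2
      ((g.continuous.comp (h.continuous_path ω)).continuousAt.tendsto.comp hs)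
  have hL : Filter.Tendsto (fun n => ∫⁻ ω in A, g (X (τ ω + c n (N n ω)) ω) ∂(Q x)) Filter.atTop
      (nhds (∫⁻ ω in A, g (X t ω) ∂(Q x))) := by
    refine tendsto_lintegral_of_dominated_convergence (fun _ => (nndist g 0 : ℝ≥0∞))
      (fun n => hg.comp (h.measurable_stopped (hτm.add (hcm n))))
      (fun n => by filter_upwards with ω using hgb _) hfin ?_
    filter_upwards with ω
    refine hconv ω _ t ?_
    have := (tendsto_const_nhds (x := τ ω)).add (hlim ω)
    rwa [add_tsub_cancel_of_le (ht ω)] at this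
  have hR : Filter.Tendsto (fun n => ∫⁻ ω in A, ∫⁻ z, g z
      ∂(timeKernel X Q (c n (N n ω), X (τ ω) ω)) ∂(Q x)) Filter.atTop
      (nhds (∫⁻ ω in A, ∫⁻ z, g z ∂(timeKernel X Q (t - τ ω, X (τ ω) ω)) ∂(Q x))) := by
    refine tendsto_lintegral_of_dominated_convergence (fun _ => (nndist g 0 : ℝ≥0∞))
      (fun n => hg.lintegral_kernel.comp ((hcm n).prodMk (h.measurable_stopped hτm)))
      (fun n => by filter_upwards with ω using hker_le _) hfin ?_
    filter_upwards with ω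
    simp only [hker]
    refine tendsto_lintegral_of_dominated_convergence (fun _ => (nndist g 0 : ℝ≥0∞))
      (fun n => hg.comp (h.measurable _)) (fun n => by filter_upwards with ω using hgb _)
      (by simp) ?_
    filter_upwards with ω'
    exact hconv ω' _ _ (hlim ω)
  simp only [e] at hL
  exact tendsto_nhds_unique hL hR

/-- The strong Markov property at the deterministic time `t`, after the stopping time `τ ≤ t`. -/
theorem measure_inter_eq (h : IsDiffusion X Q)
    (hτ : IsStoppingTime h.filtration fun ω => (τ ω : WithTop ℝ≥0)) {A : Set Ω}
    (hA : MeasurableSet[hτ.measurableSpace] A) (x : I) {t : ℝ≥0} (ht : ∀ ω, τ ω ≤ t)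
    {B : Set I} (hB : MeasurableSet B) :
    Q x (A ∩ X t ⁻¹' B) = ∫⁻ ω in A, timeKernel X Q (t - τ ω, X (τ ω) ω) B ∂(Q x) := by
  have := h.markovKernel
  have hτm : Measurable τ := (h.measurable_of_isStoppingTime hτ).mono hτ.measurableSpace_le le_rfl
  have h2 : Measurable fun ω => (t - τ ω, X (τ ω) ω) :=
    (hτm.const_sub t).prodMk (h.measurable_stopped hτm)
  have key : ((Q x).restrict A).map (X t) =
      (((Q x).restrict A).map fun ω => (t - τ ω, X (τ ω) ω)).bind (timeKernel X Q) := by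
    refine ext_of_forall_lintegral_eq_of_IsFiniteMeasure fun g => ?_
    have hg : Measurable fun z => (g z : ℝ≥0∞) := by
      have := g.continuous.measurable
      fun_prop
    rw [lintegral_map hg (h.measurable t), Measure.lintegral_bind (Kernel.aemeasurable _)
      hg.aemeasurable, lintegral_map hg.lintegral_kernel h2]
    exact h.setLIntegral_eq_of_continuous hτ hA x ht g
  have := congrArg (fun m => m B) key
  rwa [Measure.map_apply (h.measurable t) hB, Measure.restrict_apply (h.measurable t hB),
    Measure.bind_apply hB (Kernel.aemeasurable _),
    lintegral_map ((timeKernel X Q).measurable_coe hB) h2, inter_comm] at this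

/-- The weight `w (τ ω)` will carry what depends on the other, frozen path of a pair. -/
theorem lintegral_mul_indicator (h : IsDiffusion X Q)
    (hτ : IsStoppingTime h.filtration fun ω => (τ ω : WithTop ℝ≥0)) {w : ℝ≥0 → ℝ≥0∞}
    (hw : Measurable w) (x : I) {t : ℝ≥0} (ht : ∀ ω, τ ω ≤ t) {B : Set I} (hB : MeasurableSet B) :
    ∫⁻ ω, w (τ ω) * (X t ⁻¹' B).indicator 1 ω ∂(Q x) =
      ∫⁻ ω, w (τ ω) * timeKernel X Q (t - τ ω, X (τ ω) ω) B ∂(Q x) := by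
  have hτF := h.measurable_of_isStoppingTime hτ
  have hτm : Measurable τ := hτF.mono hτ.measurableSpace_le le_rfl
  have hBt : MeasurableSet (X t ⁻¹' B) := h.measurable t hB
  have hK : Measurable fun ω => timeKernel X Q (t - τ ω, X (τ ω) ω) B :=
    ((timeKernel X Q).measurable_coe hB).comp
      ((hτm.const_sub t).prodMk (h.measurable_stopped hτm))
  have key : ((Q x).withDensity ((X t ⁻¹' B).indicator 1)).map τ =
      ((Q x).withDensity fun ω => timeKernel X Q (t - τ ω, X (τ ω) ω) B).map τ := by
    refine Measure.ext fun S hS => ?_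
    rw [Measure.map_apply hτm hS, Measure.map_apply hτm hS, withDensity_apply _ (hτm hS),
      withDensity_apply _ (hτm hS), ← h.measure_inter_eq hτ (hτF hS) x ht hB,
      lintegral_indicator_one hBt, Measure.restrict_apply hBt, inter_comm]
  have e : ∀ v : Ω → ℝ≥0∞, Measurable v →
      ∫⁻ ω, w (τ ω) * v ω ∂(Q x) = ∫⁻ s, w s ∂(((Q x).withDensity v).map τ) := by
    intro v hv
    rw [lintegral_map hw hτm]
    refine .trans ?_ (lintegral_withDensity_eq_lintegral_mul _ hv (hw.comp hτm)).symm
    exact lintegral_congr fun ω => mul_comm _ _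
  rw [e _ (measurable_one.indicator hBt), e _ hK, key]

end StrongMarkov

end IsDiffusion

/-! ### Meeting of two independent copies and the Karlin–McGregor argument. -/

namespace IsDiffusion

variable {Ω : Type*} [MeasurableSpace Ω] {I : Set ℝ} {X : ℝ≥0 → Ω → I} {Q : Kernel I Ω}

/-- The first time before `t` at which the first path is not below the second one. -/
noncomputable def meetTime (X : ℝ≥0 → Ω → I) (t : ℝ≥0) (p : Ω × Ω) : ℝ≥0 :=
  hitTime (fun u => (X u p.1 : ℝ) - X u p.2) t

theorem continuous_diff (h : IsDiffusion X Q) (p : Ω × Ω) :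
    Continuous fun u => (X u p.1 : ℝ) - X u p.2 :=
  (continuous_subtype_val.comp (h.continuous_path p.1)).sub
    (continuous_subtype_val.comp (h.continuous_path p.2))

theorem measurable_meetTime (h : IsDiffusion X Q) (t : ℝ≥0) : Measurable (meetTime X t) :=
  measurable_hitTime h.continuous_diff (fun u =>
    ((h.measurable u).comp measurable_fst).subtype_val.sub
      ((h.measurable u).comp measurable_snd).subtype_val) t

theorem measurable_filtration (h : IsDiffusion X Q) {u s : ℝ≥0} (hus : u ≤ s) :
    Measurable[h.filtration s] (X u) :=
  measurable_past X hus

/-- With the second path frozen, the meeting time is the hitting time of a fixed continuous curve by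
the first path. The strong Markov property of a single copy, used twice with Fubini, thus replaces
one for the pair. -/
theorem isStoppingTime_meetTime_left (h : IsDiffusion X Q) (t : ℝ≥0) (ω₂ : Ω) :
    IsStoppingTime h.filtration fun ω => ((meetTime X t (ω, ω₂) : ℝ≥0) : WithTop ℝ≥0) := by
  intro s
  simp only [WithTop.coe_le_coe]
  exact measurableSet_hitTime_le (m := h.filtration s)
    (d := fun u ω => (X u ω : ℝ) - X u ω₂) (fun ω => h.continuous_diff (ω, ω₂))
    fun u hu => (measurable_subtype_coe.comp (h.measurable_filtration hu)).sub_const _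

theorem isStoppingTime_meetTime_right (h : IsDiffusion X Q) (t : ℝ≥0) (ω₁ : Ω) :
    IsStoppingTime h.filtration fun ω => ((meetTime X t (ω₁, ω) : ℝ≥0) : WithTop ℝ≥0) := by
  intro s
  simp only [WithTop.coe_le_coe]
  exact measurableSet_hitTime_le (m := h.filtration s)
    (d := fun u ω => (X u ω₁ : ℝ) - X u ω) (fun ω => h.continuous_diff (ω₁, ω))
    fun u hu => (measurable_subtype_coe.comp (h.measurable_filtration hu)).const_sub _

/-- The strong Markov property of a pair of independent copies at their meeting time. -/
theorem lintegral_meetTime (h : IsDiffusion X Q) (x y : I) (t : ℝ≥0) {A B : Set I}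
    (hA : MeasurableSet A) (hB : MeasurableSet B) :
    ∫⁻ p, (Iio t).indicator 1 (meetTime X t p) * (X t ⁻¹' A).indicator 1 p.1 *
        (X t ⁻¹' B).indicator 1 p.2 ∂((Q x).prod (Q y)) =
      ∫⁻ p, (Iio t).indicator 1 (meetTime X t p) *
        timeKernel X Q (t - meetTime X t p, X (meetTime X t p) p.1) A *
        timeKernel X Q (t - meetTime X t p, X (meetTime X t p) p.2) B ∂((Q x).prod (Q y)) := by
  have := h.markovKernel
  have hT := h.measurable_meetTime t
  have hind : Measurable ((Iio t).indicator (1 : ℝ≥0 → ℝ≥0∞)) :=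
    measurable_one.indicator measurableSet_Iio
  have hIA : Measurable ((X t ⁻¹' A).indicator (1 : Ω → ℝ≥0∞)) :=
    measurable_one.indicator (h.measurable t hA)
  have hIB : Measurable ((X t ⁻¹' B).indicator (1 : Ω → ℝ≥0∞)) :=
    measurable_one.indicator (h.measurable t hB)
  have hX₁ : Measurable fun p : Ω × Ω => X (meetTime X t p) p.1 :=
    h.measurable_uncurry.comp (hT.prodMk measurable_fst)
  have hX₂ : Measurable fun p : Ω × Ω => X (meetTime X t p) p.2 :=
    h.measurable_uncurry.comp (hT.prodMk measurable_snd)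
  have hK₁ : Measurable fun p => timeKernel X Q (t - meetTime X t p, X (meetTime X t p) p.1) A :=
    ((timeKernel X Q).measurable_coe hA).comp ((hT.const_sub t).prodMk hX₁)
  have hK₂ : Measurable fun p => timeKernel X Q (t - meetTime X t p, X (meetTime X t p) p.2) B :=
    ((timeKernel X Q).measurable_coe hB).comp ((hT.const_sub t).prodMk hX₂)
  have hm₁ : Measurable fun p : Ω × Ω => (Iio t).indicator (1 : ℝ≥0 → ℝ≥0∞) (meetTime X t p) *
      (X t ⁻¹' A).indicator (1 : Ω → ℝ≥0∞) p.1 := (hind.comp hT).mul (hIA.comp measurable_fst)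
  have hm₂ : Measurable fun p : Ω × Ω => (Iio t).indicator (1 : ℝ≥0 → ℝ≥0∞) (meetTime X t p) *
      timeKernel X Q (t - meetTime X t p, X (meetTime X t p) p.1) A := (hind.comp hT).mul hK₁
  have hm₃ : Measurable fun p : Ω × Ω => (Iio t).indicator (1 : ℝ≥0 → ℝ≥0∞) (meetTime X t p) *
      (X t ⁻¹' A).indicator (1 : Ω → ℝ≥0∞) p.1 * (X t ⁻¹' B).indicator (1 : Ω → ℝ≥0∞) p.2 :=
    hm₁.mul (hIB.comp measurable_snd)
  have hm₄ : Measurable fun p : Ω × Ω => (Iio t).indicator (1 : ℝ≥0 → ℝ≥0∞) (meetTime X t p) *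
      timeKernel X Q (t - meetTime X t p, X (meetTime X t p) p.1) A *
      (X t ⁻¹' B).indicator (1 : Ω → ℝ≥0∞) p.2 := hm₂.mul (hIB.comp measurable_snd)
  have hm₅ : Measurable fun p : Ω × Ω => (Iio t).indicator (1 : ℝ≥0 → ℝ≥0∞) (meetTime X t p) *
      timeKernel X Q (t - meetTime X t p, X (meetTime X t p) p.1) A *
      timeKernel X Q (t - meetTime X t p, X (meetTime X t p) p.2) B := hm₂.mul hK₂
  have hle : ∀ p, meetTime X t p ≤ t := fun p => hitTime_le _ t
  -- The intermediate integral has the kernel substituted for the first path only; the second step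
  -- freezes `ω₁` and puts the first kernel into the weight.
  trans ∫⁻ p, (Iio t).indicator 1 (meetTime X t p) *
        timeKernel X Q (t - meetTime X t p, X (meetTime X t p) p.1) A *
        (X t ⁻¹' B).indicator 1 p.2 ∂((Q x).prod (Q y))
  · rw [lintegral_prod_symm _ hm₃.aemeasurable, lintegral_prod_symm _ hm₄.aemeasurable]
    refine lintegral_congr fun ω₂ => ?_
    have hsec : Measurable fun ω : Ω => (ω, ω₂) := measurable_prodMk_right
    refine
      (lintegral_mul_const ((X t ⁻¹' B).indicator 1 ω₂) (hm₁.comp hsec)).trans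
      (.trans ?_
        (lintegral_mul_const ((X t ⁻¹' B).indicator 1 ω₂) (hm₂.comp hsec)).symm)
    congr 1
    exact h.lintegral_mul_indicator (h.isStoppingTime_meetTime_left t ω₂) hind x
      (fun ω => hle _) hA
  · rw [lintegral_prod _ hm₄.aemeasurable, lintegral_prod _ hm₅.aemeasurable]
    refine lintegral_congr fun ω₁ => ?_
    have hw : Measurable fun s : ℝ≥0 =>
        (Iio t).indicator (1 : ℝ≥0 → ℝ≥0∞) s * timeKernel X Q (t - s, X s ω₁) A :=
      hind.mul (((timeKernel X Q).measurable_coe hA).comp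
        ((measurable_id.const_sub t).prodMk (h.continuous_path ω₁).measurable))
    exact h.lintegral_mul_indicator (h.isStoppingTime_meetTime_right t ω₁) hw y
      (fun ω => hle _) hB

/-- The Karlin–McGregor theorem: the transition kernels of a one-dimensional diffusion are totally
positive of order 2. -/
theorem isTP2Kernel_transition (h : IsDiffusion X Q) (t : ℝ≥0) :
    IsTP2Kernel (transition X Q t) := by
  intro x y hxy E₁ E₂ hE₁ hE₂ hlt
  have := h.markovKernel
  have hXt := h.measurable t
  have hT := h.measurable_meetTime t
  have hstart : ∀ᵐ p ∂((Q x).prod (Q y)), X 0 p.1 = x ∧ X 0 p.2 = y := by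
    have h1 : ∀ᵐ p ∂((Q x).prod (Q y)), X 0 p.1 = x :=
      Measure.quasiMeasurePreserving_fst.ae (h.start x)
    have h2 : ∀ᵐ p ∂((Q x).prod (Q y)), X 0 p.2 = y :=
      Measure.quasiMeasurePreserving_snd.ae (h.start y)
    exact h1.and h2
  have hneg : ∀ p : Ω × Ω, X 0 p.1 = x ∧ X 0 p.2 = y → (X 0 p.1 : ℝ) - X 0 p.2 < 0 := by
    rintro p ⟨h1, h2⟩
    rw [h1, h2]
    exact sub_neg.2 hxy
  have hprod : ∀ A B : Set I, MeasurableSet A → MeasurableSet B →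
      transition X Q t x A * transition X Q t y B =
        ((Q x).prod (Q y)) ((X t ⁻¹' A) ×ˢ (X t ⁻¹' B)) := by
    intro A B hA hB
    rw [transition, Kernel.map_apply' _ hXt _ hA, Kernel.map_apply' _ hXt _ hB, Measure.prod_prod]
  have hF : ∀ A B : Set I, MeasurableSet A → MeasurableSet B →
      ((Q x).prod (Q y)) ({p | meetTime X t p < t} ∩ (X t ⁻¹' A) ×ˢ (X t ⁻¹' B)) =
      ∫⁻ p, (Iio t).indicator 1 (meetTime X t p) * (X t ⁻¹' A).indicator 1 p.1 *
        (X t ⁻¹' B).indicator 1 p.2 ∂((Q x).prod (Q y)) := by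
    intro A B hA hB
    rw [← lintegral_indicator_one ((measurableSet_lt hT measurable_const).inter
      ((hXt hA).prod (hXt hB)))]
    refine lintegral_congr fun p => ?_
    by_cases h1 : meetTime X t p < t <;> by_cases h2 : X t p.1 ∈ A <;>
      by_cases h3 : X t p.2 ∈ B <;> simp [indicator, h1, h2, h3]
  -- At a meeting time before `t` both paths are at the same point, so the two kernel factors may be
  -- exchanged.
  have hsymm : ((Q x).prod (Q y)) ({p | meetTime X t p < t} ∩ (X t ⁻¹' E₂) ×ˢ (X t ⁻¹' E₁)) =
      ((Q x).prod (Q y)) ({p | meetTime X t p < t} ∩ (X t ⁻¹' E₁) ×ˢ (X t ⁻¹' E₂)) := by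
    rw [hF _ _ hE₂ hE₁, hF _ _ hE₁ hE₂, h.lintegral_meetTime x y t hE₂ hE₁,
      h.lintegral_meetTime x y t hE₁ hE₂]
    refine lintegral_congr_ae ?_
    filter_upwards [hstart] with p hp
    by_cases hlt' : meetTime X t p < t
    · have : X (meetTime X t p) p.1 = X (meetTime X t p) p.2 := Subtype.ext
        (sub_eq_zero.1 (eq_zero_of_hitTime_lt (h.continuous_diff p) (hneg p hp) hlt'))
      rw [this, mul_right_comm]
    · simp [hlt']
  rw [hprod _ _ hE₂ hE₁, hprod _ _ hE₁ hE₂]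
  -- Starting from `x < y` and ending in `E₂ × E₁` forces a meeting strictly before `t`; once the
  -- targets are exchanged, the restriction to meeting paths is dropped.
  calc ((Q x).prod (Q y)) ((X t ⁻¹' E₂) ×ˢ (X t ⁻¹' E₁))
      ≤ ((Q x).prod (Q y)) ({p | meetTime X t p < t} ∩ (X t ⁻¹' E₂) ×ˢ (X t ⁻¹' E₁)) := by
        refine measure_mono_ae ?_
        filter_upwards [hstart] with p hp hpE
        refine ⟨hitTime_lt (h.continuous_diff p) (hneg p hp) ?_, hpE⟩
        exact sub_pos.2 (hlt _ hpE.2 _ hpE.1)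
    _ = _ := hsymm
    _ ≤ _ := measure_mono inter_subset_right

/-- The strong Markov property at the constant time `s`, integrated over the initial law. -/
theorem hasTransition (h : IsDiffusion X Q) (ρ : Measure I) :
    HasTransition X (fun s t => transition X Q (t - s)) (ρ.bind Q) := by
  intro s t hst A hA B hB
  have hA' : MeasurableSet A := past_le h.measurable s _ hA
  have hK : Measurable fun ω => transition X Q (t - s) (X s ω) B :=
    ((transition X Q (t - s)).measurable_coe hB).comp (h.measurable s)
  rw [Measure.bind_apply (hA'.inter (h.measurable t hB)) (Kernel.aemeasurable _),
    ← lintegral_indicator hA', Measure.lintegral_bind (Kernel.aemeasurable _)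
      (hK.indicator hA').aemeasurable]
  refine lintegral_congr fun x => ?_
  rw [lintegral_indicator hA']
  have hAs : MeasurableSet[(isStoppingTime_const h.filtration s).measurableSpace] A := by
    rw [IsStoppingTime.measurableSpace_const]
    exact hA
  have := h.strongMarkov (fun _ => s) (isStoppingTime_const h.filtration s) A hAs x (t - s) B hB
  simp only [add_tsub_cancel_of_le hst.le] at this
  refine this.trans (lintegral_congr fun ω => ?_)
  rw [transition, Kernel.map_apply' _ (h.measurable _) _ hB]

theorem isSCM (h : IsDiffusion X Q) (ρ : Measure I) [IsProbabilityMeasure ρ] :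
    IsSCM (fun t ω => (X t ω : ℝ)) (ρ.bind Q) := by
  have := h.markovKernel
  have hmk : ∀ t, IsMarkovKernel (transition X Q t) := fun t =>
    Kernel.IsMarkovKernel.map _ (h.measurable t)
  refine (h.hasTransition ρ).isSCM h.measurable (fun s t _ => hmk _) (fun s t hst x y hxy => ?_)
    measurable_subtype_coe (Subtype.mono_coe I) (fun t => (h.measurable t).subtype_val)
    fun t => Filter.EventuallyEq.rfl
  have := hmk (t - s)
  exact likelihoodRatioLE_of_mul_le_mul _ _ fun A B hA hB hAB =>
    h.isTP2Kernel_transition (t - s) x y hxy A B hA hB hAB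

end IsDiffusion

end SCM

theorem mainTheorem2 {Ω : Type*} [MeasurableSpace Ω] :
    -- processes with MTP₂ finite-dimensional marginals
    (∀ (μ : Measure Ω) [IsProbabilityMeasure μ] (X : ℝ≥0 → Ω → ℝ),
      (∀ t, Measurable (X t)) → SCM.HasMTP2Marginals X μ → SCM.IsSCM X μ) ∧
    -- Markov processes with absolutely continuous TP₂ transition kernels
    (∀ (μ : Measure Ω) [IsProbabilityMeasure μ] (I : Set ℝ), I.OrdConnected →
      ∀ (X : ℝ≥0 → Ω → I) (P : ℝ≥0 → ℝ≥0 → Kernel I I),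
        SCM.IsMarkovProcess X P μ →
        (∀ s t, s < t → SCM.IsAbsContKernel (P s t)) →
        (∀ s t, s < t → SCM.IsTP2Kernel (P s t)) →
        SCM.IsSCM (fun t ω => (X t ω : ℝ)) μ) ∧
    -- processes with independent increments having log-concave densities
    (∀ (μ : Measure Ω) [IsProbabilityMeasure μ] (X : ℝ≥0 → Ω → ℝ),
      (∀ t, Measurable (X t)) → SCM.HasIndepIncr X μ →
      (∀ s t, s < t → SCM.HasLogConcaveDensity (μ.map (fun ω => X t ω - X s ω))) →
      SCM.IsSCM X μ) ∧
    -- integer valued processes with independent log-concave increments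
    (∀ (μ : Measure Ω) [IsProbabilityMeasure μ] (X : ℝ≥0 → Ω → ℝ),
      (∀ t, Measurable (X t)) → (∀ t, ∀ᵐ ω ∂μ, ∃ k : ℤ, X t ω = k) → SCM.HasIndepIncr X μ →
      (∀ s t, s < t →
        SCM.IsLogConcaveSeq (fun k : ℤ => μ.real {ω | X t ω - X s ω = (k : ℝ)})) →
      SCM.IsSCM X μ) ∧
    -- one-dimensional diffusions with absolutely continuous transition kernels, any initial law
    (∀ (I : Set ℝ), I.OrdConnected → ∀ (X : ℝ≥0 → Ω → I) (Q : Kernel I Ω),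
      SCM.IsDiffusion X Q →
      (∀ t, 0 < t → SCM.IsAbsContKernel (SCM.transition X Q t)) →
      ∀ (ρ : Measure I) [IsProbabilityMeasure ρ],
        SCM.IsSCM (fun t ω => (X t ω : ℝ)) (ρ.bind Q)) := by
  refine ⟨?_, ?_, ?_, ?_, ?_⟩
  · intro μ _ X hX h
    exact SCM.HasMTP2Marginals.isSCM μ X hX h
  · intro μ _ I _ X P hX _ hP
    exact SCM.IsMarkovProcess.isSCM μ X P hX hP
  · intro μ _ X hX hi h
    exact SCM.HasIndepIncr.isSCM_of_hasLogConcaveDensity μ X hX hi h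
  · intro μ _ X hX hZ hi h
    exact SCM.HasIndepIncr.isSCM_of_isLogConcaveSeq μ X hX hZ hi h
  · intro I _ X Q h _ ρ _
    exact h.isSCM ρ
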